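/- **Setting.** A cache consists of $h\ge 1$ levels; level $i$ has $m_i\ge 1$ positions, $m=m_1+\cdots+m_h$, and $n>m$ is the number of items. A state $\boldsymbol x$ fills all $m$ positions with pairwise different items; $\mathcal S$ is the set of states. At each step one item is requested, independently of the past, item $k$ with probability $p_k$, where $p_1\ge p_2\ge\cdots\ge p_n>0$ and $\sum_k p_k=1$. The policy LRU$(\boldsymbol m)$ reacts to a request for item $k$ as follows. If $k$ is in position $j$ of level $i<h$, it moves to the first position of level $i+1$, all other items of level $i+1$ move back one position, the last item of level $i+1$ moves to the first position of level $i$, and the items that were in positions $1,\dots,j-1$ of level $i$ move back one position. If $k$ is in position $j$ of level $h$, it moves to the first position of level $h$ and the items that were in positions $1,\dots,j-1$ of level $h$ move back one position. If $k$ is not in the cache, it is inserted in the first position of level $1$, all other items of level $1$ move back one position, and the last one is evicted. Let $P$ be the transition matrix of the resulting Markov chain on $\mathcal S$. **Theorem.** The chain has a unique stationary distribution $\pi^*$, and its mixing time $$t_{\mathrm{mix}}=\min\Big\{t\ge 0:\ \max_{\boldsymbol x\in\mathcal S}\tfrac12\sum_{\boldsymbol y\in\mathcal S}\big|P^t(\boldsymbol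 x,\boldsymbol y)-\pi^*(\boldsymbol y)\big|\le\tfrac12\Big\}$$ is finite and satisfies, with a constant in the $O$ that depends only on $(m_1,\dots,m_h)$ (and not on $n$ or $p_1,\dots,p_n$), $$t_{\mathrm{mix}}=O\Bigg(\frac{n^{4m+4(m-1)(M-1)}}{B^{2}\,p_n^{2}}\; T^{4}\,\Bigg(\Big(\frac{1}{1-\sigma}\Big)^{M-1}\Bigg)^{4}\ln\frac1B\Bigg),$$ where $$M=\sum_{j=1}^h j\,m_j,\qquad B=\prod_{i=1}^h\Bigg(\prod_{k=1+\sum_{j=1}^{i-1}m_j}^{\sum_{j=1}^{i}m_j}p_{n+k-m}\Bigg)^{i},\qquad T=\prod_{i=1}^h\Bigg(\prod_{k=1+\sum_{j=1}^{i-1}m_{h-j+1}}^{\sum_{j=1}^{i}m_{h-j+1}}p_k\Bigg)^{h-i+1},\qquad \sigma=\sum_{k=1}^{m-1}p_k,$$ and empty sums are $0$. -/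

import Mathlib

namespace LRUm

open Finset

/-! ### Finite Markov chains -/

/-- `π` is a stationary probability distribution of the transition matrix `P`. -/
def IsStationary {S : Type} [Fintype S] (P : Matrix S S ℝ) (π : S → ℝ) : Prop :=
  (∀ x, 0 ≤ π x) ∧ ∑ x, π x = 1 ∧ ∀ y, ∑ x, π x * P x y = π y

/-- Total variation distance of two distributions on a finite set. -/
noncomputable def tvDist {S : Type} [Fintype S] (μ ν : S → ℝ) : ℝ :=
  (1 / 2) * ∑ x, |μ x - ν x|

/-- `t` is the mixing time `t_mix(ε)`: the smallest number of steps after which every row of the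
`t`-step transition matrix is within total variation distance `ε` of `π`. -/
def IsMixingTime {S : Type} [Fintype S] [DecidableEq S] (P : Matrix S S ℝ) (π : S → ℝ)
    (ε : ℝ) (t : ℕ) : Prop :=
  IsLeast {t : ℕ | ∀ x, tvDist (fun y => (P ^ t) x y) π ≤ ε} t

/-! ### The cache

There are `h` levels; level `i` (numbered from `0` here) has `m i ≥ 1` positions. Position `0` of a
level is its first position. The items are the elements of `Fin n`, item `0` being the most
popular one. -/

variable {h n : ℕ}

/-- The positions of the cache: pairs (level, position in that level). -/
abbrev Slot (m : Fin h → ℕ+) : Type := (i : Fin h) × Fin (m i)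

/-- A state of the cache: every position holds an item, all items being different. -/
abbrev State (m : Fin h → ℕ+) (n : ℕ) : Type := Slot m ↪ Fin n

variable {m : Fin h → ℕ+}

/-- The position just before `t` in the same level. -/
def Slot.before (t : Slot m) : Slot m :=
  ⟨t.1, ⟨t.2 - 1, by have := t.2.isLt; omega⟩⟩

/-- The last position of level `i`. -/
def lastSlot (m : Fin h → ℕ+) (i : Fin h) : Slot m :=
  ⟨i, ⟨m i - 1, by have := (m i).pos; omega⟩⟩

/-- A hit at position `s`: the position from which the new content of position `t` comes.
If `s` is in the top level, its item moves to the first position of that level and the items in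
front of it move back by one. Otherwise its item moves to the first position of the next level, the
items of the next level move back by one, the last of them moves to the first position of the level
of `s`, and the items that were in front of `s` in that level move back by one. -/
def hitSource (s t : Slot m) : Slot m :=
  if hs : (s.1 : ℕ) + 1 < h then
    if t.1 = ⟨s.1 + 1, hs⟩ then
      if (t.2 : ℕ) = 0 then s else t.before
    else if t.1 = s.1 then
      if (t.2 : ℕ) = 0 then lastSlot m ⟨s.1 + 1, hs⟩
      else if (t.2 : ℕ) ≤ s.2 then t.before else t
    else t
  else
    if t.1 = s.1 then
      if (t.2 : ℕ) = 0 then s else if (t.2 : ℕ) ≤ s.2 then t.before else t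
    else t

/-- A miss on item `k`: it is inserted in the first position of the lowest level, the items of that
level move back by one, and the last of them is evicted. -/
def missContent (x : Slot m → Fin n) (k : Fin n) (t : Slot m) : Fin n :=
  if (t.1 : ℕ) = 0 then
    if (t.2 : ℕ) = 0 then k else x t.before
  else x t

theorem slot_ext {s t : Slot m} (h1 : (s.1 : ℕ) = t.1) (h2 : (s.2 : ℕ) = t.2) : s = t := by
  obtain ⟨i, a⟩ := s
  obtain ⟨j, b⟩ := t
  obtain rfl : i = j := Fin.ext h1
  obtain rfl : a = b := Fin.ext h2
  rfl

theorem slot_eq_iff {s t : Slot m} : s = t ↔ (s.1 : ℕ) = t.1 ∧ (s.2 : ℕ) = t.2 :=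
  ⟨fun e => by subst e; exact ⟨rfl, rfl⟩, fun e => slot_ext e.1 e.2⟩

theorem hitSource_injective (s : Slot m) : Function.Injective (hitSource s) := by
  intro t u htu
  have hs := s.2.isLt
  have ht := t.2.isLt
  have hu := u.2.isLt
  have cong : ∀ i j : Fin h, i = j → (m i : ℕ) = m j := fun i j e => by rw [e]
  unfold hitSource at htu
  split_ifs at htu <;> rw [slot_eq_iff] at htu ⊢ <;>
    (try simp only [Slot.before, lastSlot] at htu) <;>
    (try have c1 := cong t.1 _ (by assumption)) <;>
    (try have c2 := cong u.1 _ (by assumption)) <;>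
    (try simp only [Fin.ext_iff] at *) <;> omega

theorem missContent_injective (x : State m n) (k : Fin n) (hk : ¬ ∃ s, x s = k) :
    Function.Injective (missContent x k) := by
  intro t u htu
  simp only [missContent] at htu
  have key : ∀ s, x s ≠ k := fun s e => hk ⟨s, e⟩
  split_ifs at htu <;>
    first
    | exact absurd htu (key _)
    | exact absurd htu.symm (key _)
    | (try have e := slot_eq_iff.1 (x.injective htu)
       try simp only [Slot.before] at *
       exact slot_ext (by omega) (by omega))

open Classical in
/-- The state of the cache after a request for item `k` in state `x`. -/
noncomputable def request (x : State m n) (k : Fin n) : State m n :=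
  if hk : ∃ s, x s = k then
    ⟨fun t => x (hitSource hk.choose t), x.injective.comp (hitSource_injective hk.choose)⟩
  else
    ⟨missContent x k, missContent_injective x k hk⟩

open Classical in
/-- The transition matrix of LRU(m) when the requests are independent and item `k` is requested
with probability `p k`. -/
noncomputable def transition (m : Fin h → ℕ+) (p : Fin n → ℝ) :
    Matrix (State m n) (State m n) ℝ :=
  fun x y => ∑ k, if request x k = y then p k else 0

/-! ### The quantities in the bound -/

/-- The total cache size `m₁ + ⋯ + m_h`. -/
def totalSize (m : Fin h → ℕ+) : ℕ := ∑ i, (m i : ℕ)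

/-- `m₁ + 2 m₂ + ⋯ + h m_h`. -/
def weightedSize (m : Fin h → ℕ+) : ℕ := ∑ i : Fin h, ((i : ℕ) + 1) * (m i : ℕ)

/-- `p_k`, the probability of the `k`-th item, for `1 ≤ k ≤ n`; it is used for such `k` only. -/
def prob (p : Fin n → ℝ) (k : ℕ) : ℝ :=
  if hk : 1 ≤ k ∧ k ≤ n then p ⟨k - 1, by omega⟩ else 0

/-- `∏_{i=1}^h (∏_{k = 1 + m₁ + ⋯ + m_{i-1}}^{m₁ + ⋯ + m_i} p_{n+k-m})^i`. -/
noncomputable def bottomProd (m : Fin h → ℕ+) (p : Fin n → ℝ) : ℝ :=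
  ∏ i : Fin h,
    (∏ k ∈ Finset.Icc (1 + ∑ j ∈ Finset.univ.filter (· < i), (m j : ℕ))
        (∑ j ∈ Finset.univ.filter (· ≤ i), (m j : ℕ)),
      prob p (n + k - totalSize m)) ^ ((i : ℕ) + 1)

/-- `∏_{i=1}^h (∏_{k = 1 + m_h + ⋯ + m_{h-i+2}}^{m_h + ⋯ + m_{h-i+1}} p_k)^{h-i+1}`. -/
noncomputable def topProd (m : Fin h → ℕ+) (p : Fin n → ℝ) : ℝ :=
  ∏ i : Fin h,
    (∏ k ∈ Finset.Icc (1 + ∑ j ∈ Finset.univ.filter (· < i), (m j.rev : ℕ))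
        (∑ j ∈ Finset.univ.filter (· ≤ i), (m j.rev : ℕ)),
      prob p k) ^ (h - (i : ℕ))

/-- The largest total probability of the at most `m - 1` different items that may be requested
between two consecutive fixed requests: `p₁ + ⋯ + p_{m-1}`. -/
noncomputable def gapMass (m : Fin h → ℕ+) (p : Fin n → ℝ) : ℝ :=
  ∑ k ∈ Finset.Icc 1 (totalSize m - 1), prob p k

/-- The expression inside the `O`. -/
noncomputable def mixingBound (m : Fin h → ℕ+) (p : Fin n → ℝ) : ℝ :=
  (n : ℝ) ^ (4 * totalSize m + 4 * (totalSize m - 1) * (weightedSize m - 1))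
      / (bottomProd m p ^ 2 * prob p n ^ 2)
    * topProd m p ^ 4
    * ((1 / (1 - gapMass m p)) ^ (weightedSize m - 1)) ^ 4
    * Real.log (1 / bottomProd m p)

end LRUm

namespace LRUm

open Finset

/-! ### Finite Markov chains: stationarity and minorization -/

section Markov

variable {S : Type} [Fintype S] [DecidableEq S] {P : Matrix S S ℝ}

/-! The argument finds a random time, read off the requests alone, at which the cache is in one
fixed state whatever its initial state. If this happens within `t` steps with probability at least
1/2, the rows of `P ^ t` share a common part of mass at least 1/2 (`exists_minorization`). This
bounds the mixing time by `t` and makes the stationary distribution unique.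

Read the cache from the top level downwards. A hit rotates an interval of positions by one place
(`hitSource_eq_or`), so a set `A` filling the first `#A` positions stays there under requests from
`A`, and `h` requests of a further item bring that item up to it (`leads_insert`). Patterns of such
steps force the nested family of sets `popular n i`, and hence the state `sorted`, in which items 0,
1, ... occupy the positions in order (`leads_sorted`).

A pattern entry is met, before a request that ruins it, with probability `odds`. The mean time to
complete a pattern is therefore at most its length divided by `q` times the product of the odds,
with `1 / q` bounding the mean wait per entry (`one_add_sum_potential_le`); Markov's inequality does
the rest. With `N` the cache size, the cutoff is the total probability of all items beyond the first
`N`. Items above it have odds at least `1 / (N + 1)`. Items below it have odds at least `1 / ((N +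
1) n)`, but the pattern asks for each of them only `h` times. This gives a time of order `n ^ (h N)
/ (1 - σ)`.

Finally `le_mixingBound` shows by elementary estimates that the stated expression is at least of
that order. -/

theorem exists_isStationary [Nonempty S] (h0 : ∀ x y, 0 ≤ P x y) (h1 : ∀ x, ∑ y, P x y = 1) :
    ∃ π, IsStationary P π := by
  -- The constant vector is a right fixed vector of `P`, so `P` also has a nonzero left fixed vector
  -- `v`, of unknown signs.
  have hdet : (P - 1).det = 0 := by
    rw [← Matrix.exists_mulVec_eq_zero_iff]
    refine ⟨fun _ => 1, fun h => ?_, ?_⟩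
    · obtain ⟨x⟩ := ‹Nonempty S›
      exact one_ne_zero (congrFun h x)
    · ext x
      rw [Matrix.sub_mulVec, Matrix.one_mulVec]
      simp [Matrix.mulVec, dotProduct, h1]
  obtain ⟨v, hv0, hv⟩ := Matrix.exists_vecMul_eq_zero_iff.2 hdet
  have hvP : ∀ y, ∑ x, v x * P x y = v y := by
    intro y
    have := congrFun hv y
    rw [Matrix.vecMul_sub, Matrix.vecMul_one] at this
    simpa [Matrix.vecMul, dotProduct, sub_eq_zero] using this
  -- Both sides have the same total mass because rows sum to one, so this inequality is an equality
  -- everywhere and `|v|` can be normalized.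
  have hle : ∀ y ∈ univ, |v y| ≤ ∑ x, |v x| * P x y := by
    intro y _
    rw [← hvP y]
    refine (abs_sum_le_sum_abs _ _).trans (sum_le_sum fun x _ => ?_)
    rw [abs_mul, abs_of_nonneg (h0 x y)]
  have hsum : ∑ y, |v y| = ∑ y, ∑ x, |v x| * P x y := by
    rw [sum_comm]
    simp [← mul_sum, h1]
  have heq := (sum_eq_sum_iff_of_le hle).1 hsum
  have hpos : 0 < ∑ x, |v x| := by
    obtain ⟨x, hx⟩ := Function.ne_iff.1 hv0
    exact sum_pos' (fun _ _ => abs_nonneg _) ⟨x, mem_univ x, abs_pos.2 hx⟩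
  refine ⟨fun x => |v x| / ∑ x, |v x|, fun x => by positivity, ?_, fun y => ?_⟩
  · rw [← sum_div, div_self hpos.ne']
  · calc ∑ x, |v x| / (∑ x, |v x|) * P x y = (∑ x, |v x| * P x y) / ∑ x, |v x| := by
          rw [sum_div]
          exact sum_congr rfl fun x _ => by ring
      _ = |v y| / ∑ x, |v x| := by rw [← heq y (mem_univ y)]

theorem pow_row_sum (h1 : ∀ x, ∑ y, P x y = 1) (t : ℕ) (x : S) : ∑ y, (P ^ t) x y = 1 := by
  induction t generalizing x with
  | zero => simp [Matrix.one_apply]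
  | succ t ih =>
    simp only [pow_succ', Matrix.mul_apply]
    rw [sum_comm]
    simp [← mul_sum, ih, h1]

theorem IsStationary.pow {π : S → ℝ} (hπ : IsStationary P π) (t : ℕ) (y : S) :
    ∑ x, π x * (P ^ t) x y = π y := by
  induction t generalizing y with
  | zero => simp [Matrix.one_apply]
  | succ t ih =>
    simp only [pow_succ, Matrix.mul_apply, mul_sum]
    rw [sum_comm]
    simp only [← mul_assoc, ← sum_mul, ih]
    exact hπ.2.2 y

theorem IsStationary.minorization_le {π : S → ℝ} (hπ : IsStationary P π) {t : ℕ} {s : S → ℝ}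
    (hs : ∀ x y, s y ≤ (P ^ t) x y) (y : S) : s y ≤ π y := by
  rw [← hπ.pow t y]
  calc s y = ∑ x, π x * s y := by rw [← sum_mul, hπ.2.1, one_mul]
    _ ≤ _ := sum_le_sum fun x _ => mul_le_mul_of_nonneg_left (hs x y) (hπ.1 x)

/-- Since `s` lies below both the row and `π`, the pointwise difference is at most the sum of the
two excesses over `s`, each of total mass `1 - ∑ s`. -/
theorem tvDist_le_of_minorization (h1 : ∀ x, ∑ y, P x y = 1) {π : S → ℝ}
    (hπ : IsStationary P π) {t : ℕ} {s : S → ℝ} (hs : ∀ x y, s y ≤ (P ^ t) x y) (x : S) :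
    tvDist (fun y => (P ^ t) x y) π ≤ 1 - ∑ y, s y := by
  have hle : ∑ y, |(P ^ t) x y - π y| ≤ ∑ y, (((P ^ t) x y - s y) + (π y - s y)) := by
    refine sum_le_sum fun y _ => ?_
    have := hs x y
    have := hπ.minorization_le hs y
    rw [abs_le]
    constructor <;> linarith
  simp only [sum_add_distrib, sum_sub_distrib, pow_row_sum h1, hπ.2.1] at hle
  unfold tvDist
  linarith

/-- The difference `d` has total mass zero, so `s` may be subtracted from every row without changing
`d P ^ t`. Hence the ℓ¹ norm of `d` is at most `1 - ∑ s` times itself, and `d = 0`. -/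
theorem IsStationary.eq_of_minorization (h1 : ∀ x, ∑ y, P x y = 1) {π π' : S → ℝ}
    (hπ : IsStationary P π) (hπ' : IsStationary P π') {t : ℕ} {s : S → ℝ}
    (hs : ∀ x y, s y ≤ (P ^ t) x y) (hpos : 0 < ∑ y, s y) : π' = π := by
  set d : S → ℝ := fun x => π' x - π x with hd
  have hdsum : ∑ x, d x = 0 := by simp [hd, hπ.2.1, hπ'.2.1]
  have hdP : ∀ y, ∑ x, d x * ((P ^ t) x y - s y) = d y := by
    intro y
    simp only [mul_sub, sum_sub_distrib, ← sum_mul, hdsum, zero_mul, sub_zero]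
    simp only [hd, sub_mul, sum_sub_distrib, hπ.pow, hπ'.pow]
  have hle : ∑ y, |d y| ≤ ∑ y, ∑ x, |d x| * ((P ^ t) x y - s y) := by
    refine sum_le_sum fun y _ => ?_
    calc |d y| = |∑ x, d x * ((P ^ t) x y - s y)| := by rw [hdP]
      _ ≤ ∑ x, |d x * ((P ^ t) x y - s y)| := abs_sum_le_sum_abs _ _
      _ = _ := sum_congr rfl fun x _ => by
        rw [abs_mul, abs_of_nonneg (sub_nonneg.2 (hs x y))]
  rw [sum_comm] at hle
  simp only [← mul_sum, sum_sub_distrib, pow_row_sum h1] at hle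
  rw [← sum_mul] at hle
  have hnn : 0 ≤ ∑ y, |d y| := sum_nonneg fun _ _ => abs_nonneg _
  have hz : ∑ y, |d y| = 0 := by nlinarith
  rw [sum_eq_zero_iff_of_nonneg fun _ _ => abs_nonneg _] at hz
  ext x
  exact sub_eq_zero.1 (abs_eq_zero.1 (hz x (mem_univ x)))

end Markov

/-! ### The chain driven by random requests -/

section Driven

variable {h n : ℕ} {m : Fin h → ℕ+} {p : Fin n → ℝ}

theorem transition_nonneg (hp : ∀ k, 0 < p k) (x y : State m n) : 0 ≤ transition m p x y :=
  sum_nonneg fun k _ => by split_ifs <;> simp [(hp k).le]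

theorem transition_row_sum (hp1 : ∑ k, p k = 1) (x : State m n) :
    ∑ y, transition m p x y = 1 := by
  unfold transition
  rw [sum_comm]
  simp [hp1]

theorem transition_pow_succ_apply (t : ℕ) (x y : State m n) :
    (transition m p ^ (t + 1)) x y = ∑ k, p k * (transition m p ^ t) (request x k) y := by
  classical
  rw [pow_succ', Matrix.mul_apply]
  simp only [transition, sum_mul]
  rw [sum_comm]
  refine sum_congr rfl fun k _ => ?_
  simp [ite_mul]

variable {G : Type} (next : G → Fin n → G) (goal : G → Prop) (p)

open Classical in
/-- The probability that a monitor started in `g` and reading random requests has not met `goal`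
within `t` steps. -/
noncomputable def survival : ℕ → G → ℝ
  | 0, g => if goal g then 0 else 1
  | t + 1, g => if goal g then 0 else ∑ k, p k * survival t (next g k)

variable {p}

theorem survival_of_goal {g : G} (hg : goal g) (t : ℕ) : survival p next goal t g = 0 := by
  cases t <;> simp [survival, hg]

theorem survival_nonneg (hp : ∀ k, 0 < p k) (t : ℕ) (g : G) : 0 ≤ survival p next goal t g := by
  induction t generalizing g with
  | zero => unfold survival; split_ifs <;> simp
  | succ t ih =>
    unfold survival
    split_ifs
    · exact le_rfl
    · exact sum_nonneg fun k _ => mul_nonneg (hp k).le (ih _)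

theorem survival_succ_le (hp : ∀ k, 0 < p k) (hp1 : ∑ k, p k = 1) (t : ℕ) (g : G) :
    survival p next goal (t + 1) g ≤ survival p next goal t g := by
  induction t generalizing g with
  | zero =>
    by_cases hg : goal g
    · simp [survival, hg]
    · simp only [survival, hg, if_false]
      refine (sum_le_sum fun k _ => ?_).trans hp1.le
      have := (hp k).le
      split_ifs <;> simp [this]
  | succ t ih =>
    by_cases hg : goal g
    · simp [survival, hg]
    · rw [survival, survival, if_neg hg, if_neg hg]
      exact sum_le_sum fun k _ => mul_le_mul_of_nonneg_left (ih _) (hp k).le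

/-- Drift criterion: a nonnegative function that decreases by at least one per step on average
bounds the expected hitting time, written here as a sum of survival probabilities. -/
theorem sum_survival_le (hp : ∀ k, 0 < p k) {V : G → ℝ} (hV0 : ∀ g, 0 ≤ V g)
    (hV : ∀ g, ¬ goal g → 1 + ∑ k, p k * V (next g k) ≤ V g) (t : ℕ) (g : G) :
    ∑ s ∈ range t, survival p next goal s g ≤ V g := by
  induction t generalizing g with
  | zero => simpa using hV0 g
  | succ t ih =>
    by_cases hg : goal g
    · simpa [survival_of_goal next goal hg] using hV0 g
    · rw [sum_range_succ']
      simp only [survival, hg, if_false]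
      rw [sum_comm]
      simp only [← mul_sum]
      refine le_trans ?_ (hV g hg)
      rw [add_comm]
      gcongr with k
      · exact (hp k).le
      · exact ih _

/-- Markov's inequality: survival is decreasing in time, so `t + 1` copies of the last value are
below the sum. -/
theorem survival_mul_le (hp : ∀ k, 0 < p k) (hp1 : ∑ k, p k = 1) {V : G → ℝ}
    (hV0 : ∀ g, 0 ≤ V g) (hV : ∀ g, ¬ goal g → 1 + ∑ k, p k * V (next g k) ≤ V g)
    (t : ℕ) (g : G) : (t + 1) * survival p next goal t g ≤ V g := by
  refine le_trans ?_ (sum_survival_le next goal hp hV0 hV (t + 1) g)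
  have hanti : Antitone fun t => survival p next goal t g :=
    antitone_nat_of_succ_le fun t => survival_succ_le next goal hp hp1 t g
  calc ((t : ℝ) + 1) * survival p next goal t g
      = ∑ s ∈ range (t + 1), survival p next goal t g := by simp
    _ ≤ _ := sum_le_sum fun s hs => hanti (Nat.lt_succ_iff.1 (mem_range.1 hs))

/-- If the monitor state restricts the cache state, and a goal state of the monitor determines it,
then the rows of `P ^ t` have a common part of mass at least the probability of meeting the goal. -/
theorem exists_minorization (hp : ∀ k, 0 < p k) (hp1 : ∑ k, p k = 1) {inv : G → State m n → Prop}
    (hinv : ∀ g x k, ¬ goal g → inv g x → inv (next g k) (request x k)) {z : State m n}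
    (hz : ∀ g x, goal g → inv g x → x = z) (t : ℕ) (g : G) :
    ∃ s : State m n → ℝ, (∀ y, 0 ≤ s y) ∧ 1 - survival p next goal t g ≤ ∑ y, s y ∧
      ∀ x, inv g x → ∀ y, s y ≤ (transition m p ^ t) x y := by
  have hnn : ∀ (t : ℕ) (x y : State m n), 0 ≤ (transition m p ^ t) x y := by
    intro t
    induction t with
    | zero => intro x y; simp only [pow_zero, Matrix.one_apply]; split_ifs <;> simp
    | succ t ih =>
      intro x y
      rw [transition_pow_succ_apply]
      exact sum_nonneg fun k _ => mul_nonneg (hp k).le (ih _ _)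
  -- At a goal the only admissible state is `z`, so the row of `z` itself is the common part.
  have hgoal : ∀ (t : ℕ) (g : G), goal g →
      ∃ s : State m n → ℝ, (∀ y, 0 ≤ s y) ∧ 1 - survival p next goal t g ≤ ∑ y, s y ∧
      ∀ x, inv g x → ∀ y, s y ≤ (transition m p ^ t) x y := by
    intro t g hg
    refine ⟨fun y => (transition m p ^ t) z y, hnn t z, ?_, ?_⟩
    · rw [pow_row_sum (transition_row_sum hp1)]
      linarith [survival_nonneg next goal hp t g]
    · intro x hx y
      rw [hz g x hg hx]
  induction t generalizing g with
  | zero =>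
    by_cases hg : goal g
    · exact hgoal _ _ hg
    · exact ⟨fun _ => 0, fun _ => le_rfl, by simp [survival, hg], fun x _ y => hnn 0 x y⟩
  | succ t ih =>
    by_cases hg : goal g
    · exact hgoal _ _ hg
    · choose s hs0 hs1 hs2 using ih
      -- All starting states read the same request `k`, so the common parts after one step average
      -- to a common part now.
      refine ⟨fun y => ∑ k, p k * s (next g k) y, fun y => sum_nonneg fun k _ =>
        mul_nonneg (hp k).le (hs0 _ _), ?_, fun x hx y => ?_⟩
      · rw [sum_comm]
        simp only [← mul_sum]
        rw [survival, if_neg hg]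
        calc 1 - ∑ k, p k * survival p next goal t (next g k)
            = ∑ k, p k * (1 - survival p next goal t (next g k)) := by
              simp only [mul_sub, mul_one, sum_sub_distrib, hp1]
          _ ≤ _ := sum_le_sum fun k _ => mul_le_mul_of_nonneg_left (hs1 _) (hp k).le
      · rw [transition_pow_succ_apply]
        exact sum_le_sum fun k _ =>
          mul_le_mul_of_nonneg_left (hs2 _ _ (hinv g x k hg hx) y) (hp k).le

end Driven

/-! ### The cache as a list, read from the top level downwards -/

section Rank

variable {h n : ℕ} {m : Fin h → ℕ+}

/-- The number of positions in the levels above level `i`. -/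
def above (m : Fin h → ℕ+) (i : Fin h) : ℕ := ∑ j ∈ univ.filter (i < ·), (m j : ℕ)

/-- The number of positions in front of `t`, higher levels coming first. -/
def Slot.rank (t : Slot m) : ℕ := above m t.1 + t.2

theorem above_add_le {i j : Fin h} (hij : i < j) : above m j + m j ≤ above m i := by
  have hj : j ∉ univ.filter (j < ·) := by simp
  rw [above, above, add_comm, ← sum_insert (f := fun j => (m j : ℕ)) hj]
  refine sum_le_sum_of_subset fun k hk => ?_
  simp only [mem_insert, mem_filter, mem_univ, true_and] at hk ⊢
  rcases hk with rfl | hk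
  · exact hij
  · exact hij.trans hk

theorem above_eq_succ {i : Fin h} (hi : (i : ℕ) + 1 < h) :
    above m i = above m ⟨i + 1, hi⟩ + m ⟨i + 1, hi⟩ := by
  have hj : (⟨i + 1, hi⟩ : Fin h) ∉ univ.filter ((⟨i + 1, hi⟩ : Fin h) < ·) := by simp
  rw [above, above, add_comm, ← sum_insert (f := fun j => (m j : ℕ)) hj]
  congr 1
  ext k
  simp only [mem_insert, mem_filter, mem_univ, true_and, Fin.lt_def, Fin.ext_iff]
  omega

theorem above_eq_zero {i : Fin h} (hi : ¬ (i : ℕ) + 1 < h) : above m i = 0 := by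
  rw [above, filter_eq_empty_iff.2, sum_empty]
  intro k _ hk
  have := k.isLt
  rw [Fin.lt_def] at hk
  omega

theorem above_add_le_totalSize (i : Fin h) : above m i + m i ≤ totalSize m := by
  have hj : i ∉ univ.filter (i < ·) := by simp
  rw [above, totalSize, add_comm, ← sum_insert (f := fun j => (m j : ℕ)) hj]
  exact sum_le_sum_of_subset (subset_univ _)

theorem rank_lt_totalSize (t : Slot m) : t.rank < totalSize m := by
  have := above_add_le_totalSize (m := m) t.1
  have := t.2.isLt
  unfold Slot.rank
  omega

theorem rank_lt_of_level_lt {s t : Slot m} (hst : s.1 < t.1) : t.rank < s.rank := by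
  have := above_add_le (m := m) hst
  have := t.2.isLt
  unfold Slot.rank
  omega

theorem rank_injective : Function.Injective (Slot.rank (m := m)) := by
  intro s t hst
  rcases lt_trichotomy s.1 t.1 with h1 | h1 | h1
  · exact absurd hst (rank_lt_of_level_lt h1).ne'
  · refine slot_ext (congrArg _ h1) ?_
    have := congrArg (above m) h1
    unfold Slot.rank at hst
    omega
  · exact absurd hst (rank_lt_of_level_lt h1).ne

theorem exists_rank_eq {r : ℕ} (hr : r < totalSize m) : ∃ t : Slot m, t.rank = r := by
  have hb : Function.Bijective
      fun t : Slot m => (⟨t.rank, rank_lt_totalSize t⟩ : Fin (totalSize m)) := by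
    rw [Fintype.bijective_iff_injective_and_card]
    refine ⟨fun s t hst => rank_injective (by simpa using hst), ?_⟩
    rw [Fintype.card_fin, Fintype.card_sigma]
    simp [totalSize]
  obtain ⟨t, ht⟩ := hb.2 ⟨r, hr⟩
  exact ⟨t, by simpa using ht⟩

/-- The position to which the item in position `s` moves when it is requested. -/
def landing (s : Slot m) : Slot m :=
  ⟨if hs : (s.1 : ℕ) + 1 < h then ⟨s.1 + 1, hs⟩ else s.1, ⟨0, (m _).pos⟩⟩

theorem landing_snd (s : Slot m) : ((landing s).2 : ℕ) = 0 := rfl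

theorem rank_landing_le (s : Slot m) : (landing s).rank ≤ s.rank := by
  by_cases hs : (s.1 : ℕ) + 1 < h
  · exact (rank_lt_of_level_lt (by simp [landing, hs, Fin.lt_def])).le
  · have h1 : (landing s).1 = s.1 := by simp [landing, hs]
    rw [Slot.rank, landing_snd, h1]
    exact Nat.le_add_right _ _

theorem rank_landing_of_top {s : Slot m} (hs : ¬ (s.1 : ℕ) + 1 < h) : (landing s).rank = 0 := by
  have h1 : (landing s).1 = s.1 := by simp [landing, hs]
  rw [Slot.rank, landing_snd, h1, above_eq_zero hs]

theorem level_landing {s : Slot m} (hs : (s.1 : ℕ) + 1 < h) :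
    ((landing s).1 : ℕ) = s.1 + 1 := by
  simp [landing, hs]

theorem hitSource_landing (s : Slot m) : hitSource s (landing s) = s := by
  have h2 := landing_snd s
  by_cases hs : (s.1 : ℕ) + 1 < h
  · have h1 : (landing s).1 = ⟨s.1 + 1, hs⟩ := by simp [landing, hs]
    simp only [hitSource, dif_pos hs, if_pos h1, if_pos h2]
  · have h1 : (landing s).1 = s.1 := by simp [landing, hs]
    simp only [hitSource, dif_neg hs, if_pos h1, if_pos h2]

theorem rank_before {t : Slot m} (ht : (t.2 : ℕ) ≠ 0) : t.before.rank + 1 = t.rank := by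
  simp only [Slot.rank, Slot.before]
  omega

/-- Away from the landing position, the content of a position comes from the position one place in
front of it if it lies between the landing position and the position of the request, and does not
change otherwise. -/
theorem hitSource_eq_or (s t : Slot m) (ht : t ≠ landing s) :
    (hitSource s t = t ∧ (t.rank < (landing s).rank ∨ s.rank < t.rank)) ∨
      ((hitSource s t).rank + 1 = t.rank ∧ (landing s).rank < t.rank ∧ t.rank ≤ s.rank) := by
  have hs2 := s.2.isLt
  have ht2 := t.2.isLt
  -- Within one level ranks differ as the positions do; stated additively to avoid subtraction of
  -- natural numbers.
  have hlvl : ∀ {u v : Slot m}, u.1 = v.1 → ∀ {a b : ℕ}, (u.2 : ℕ) = a → (v.2 : ℕ) = b →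
      u.rank + b = v.rank + a := by
    intro u v huv a b ha hb
    have := congrArg (above m) huv
    unfold Slot.rank
    omega
  by_cases hs : (s.1 : ℕ) + 1 < h
  · have hl1 : (landing s).1 = ⟨s.1 + 1, hs⟩ := Fin.ext (level_landing hs)
    have hl2 := landing_snd s
    have hls : (landing s).rank < s.rank := rank_lt_of_level_lt (by rw [hl1]; simp [Fin.lt_def])
    unfold hitSource
    rw [dif_pos hs]
    split_ifs with h1 h2 h2 h3 h4
    · exact absurd (slot_ext (by rw [h1, hl1]) (by rw [h2, hl2])) ht
    · right
      have e := hlvl (h1.trans hl1.symm) rfl hl2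
      have : t.rank < s.rank := rank_lt_of_level_lt (by rw [h1]; simp [Fin.lt_def])
      exact ⟨rank_before h2, by omega, this.le⟩
    · right
      have e := hlvl h2 h3 rfl
      have hab := above_eq_succ (m := m) hs
      have hpos := (m ⟨s.1 + 1, hs⟩).pos
      have htr : t.rank = above m s.1 := by
        have := congrArg (above m) h2
        unfold Slot.rank
        omega
      refine ⟨?_, rank_lt_of_level_lt (by rw [h2, hl1]; simp [Fin.lt_def]), by omega⟩
      simp only [Slot.rank, lastSlot] at htr ⊢
      omega
    · right
      have e := hlvl h2 rfl rfl
      exact ⟨rank_before h3, rank_lt_of_level_lt (by rw [h2, hl1]; simp [Fin.lt_def]), by omega⟩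
    · left
      have e := hlvl h2 rfl rfl
      exact ⟨rfl, Or.inr (by omega)⟩
    · left
      refine ⟨rfl, ?_⟩
      rcases lt_or_gt_of_ne (Fin.val_ne_of_ne h2) with h5 | h5
      · exact Or.inr (rank_lt_of_level_lt h5)
      · refine Or.inl (rank_lt_of_level_lt ?_)
        rw [hl1, Fin.lt_def]
        have := Fin.val_ne_of_ne h1
        simp only at this ⊢
        omega
  · have hl1 : (landing s).1 = s.1 := by simp [landing, hs]
    have hl2 := landing_snd s
    unfold hitSource
    rw [dif_neg hs]
    split_ifs with h1 h2 h3
    · exact absurd (slot_ext (by rw [h1, hl1]) (by rw [h2, hl2])) ht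
    · right
      have e := hlvl h1 rfl rfl
      have e' := hlvl (h1.trans hl1.symm) rfl hl2
      exact ⟨rank_before h2, by omega, by omega⟩
    · left
      have e := hlvl h1 rfl rfl
      exact ⟨rfl, Or.inr (by omega)⟩
    · left
      refine ⟨rfl, Or.inr (rank_lt_of_level_lt ?_)⟩
      rw [Fin.lt_def]
      have := Fin.val_ne_of_ne h1
      have := t.1.isLt
      omega

theorem request_of_hit {x : State m n} {s : Slot m} {k : Fin n} (hs : x s = k) (t : Slot m) :
    request x k t = x (hitSource s t) := by
  have hk : ∃ s, x s = k := ⟨s, hs⟩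
  have : hk.choose = s := x.injective (hk.choose_spec.trans hs.symm)
  simp only [request, dif_pos hk, Function.Embedding.coeFn_mk, this]

theorem request_of_miss {x : State m n} {k : Fin n} (hk : ¬ ∃ s, x s = k) (t : Slot m) :
    request x k t = missContent x k t := by
  simp only [request, dif_neg hk, Function.Embedding.coeFn_mk]

end Rank

/-! ### Sets of items occupying the top of the cache -/

section Top

variable {h n : ℕ} {m : Fin h → ℕ+}

/-- The first `#A` positions, from the top, hold items of `A`. -/
def Top (A : Finset (Fin n)) (x : State m n) : Prop := ∀ t : Slot m, t.rank < #A → x t ∈ A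

/-- By pigeonhole: the first `#A` positions hold `#A` different items, all of them in `A`, hence all
of `A`. -/
theorem Top.exists_slot {A : Finset (Fin n)} {x : State m n} (hA : Top A x)
    (hm : #A ≤ totalSize m) {k : Fin n} (hk : k ∈ A) : ∃ s, x s = k ∧ s.rank < #A := by
  classical
  set R : Finset (Slot m) := univ.filter fun t => t.rank < #A
  have hR : R.image Slot.rank = range #A := by
    ext r
    simp only [R, mem_image, mem_filter, mem_univ, true_and, mem_range]
    constructor
    · rintro ⟨t, ht, rfl⟩
      exact ht
    · intro hr
      obtain ⟨t, rfl⟩ := exists_rank_eq (hr.trans_le hm)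
      exact ⟨t, hr, rfl⟩
  have hcard : #R = #A := by
    rw [← card_image_of_injective R rank_injective, hR, card_range]
  have himg : R.map x = A := by
    refine eq_of_subset_of_card_le (fun k hk => ?_) (by rw [card_map, hcard])
    obtain ⟨t, ht, rfl⟩ := mem_map.1 hk
    exact hA t (mem_filter.1 ht).2
  rw [← himg, mem_map] at hk
  obtain ⟨s, hs, rfl⟩ := hk
  exact ⟨s, rfl, (mem_filter.1 hs).2⟩

/-- The landing position receives `k`, which is in `A`; every other position is refilled from one of
no larger rank. -/
theorem Top.request_mem {A : Finset (Fin n)} {x : State m n} (hA : Top A x)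
    (hm : #A ≤ totalSize m) {k : Fin n} (hk : k ∈ A) : Top A (request x k) := by
  obtain ⟨s, hs, hsA⟩ := hA.exists_slot hm hk
  intro t ht
  rw [request_of_hit hs]
  by_cases hts : t = landing s
  · rw [hts, hitSource_landing, hs]
    exact hk
  · apply hA
    rcases hitSource_eq_or s t hts with ⟨e, -⟩ | ⟨e, -⟩
    · rwa [e]
    · omega

/-- The rotation ends at the old position of `k`, whose rank is below `#A`. -/
theorem Top.request_apply_of_le {A : Finset (Fin n)} {x : State m n} (hA : Top A x)
    (hm : #A ≤ totalSize m) {k : Fin n} (hk : k ∈ A) {t : Slot m} (ht : #A ≤ t.rank) :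
    request x k t = x t := by
  obtain ⟨s, hs, hsA⟩ := hA.exists_slot hm hk
  rw [request_of_hit hs]
  have := rank_landing_le s
  rcases hitSource_eq_or s t (by rintro rfl; omega) with ⟨e, -⟩ | ⟨-, -, e⟩
  · rw [e]
  · omega

/-- Item `e` is in level `j` or higher (levels counted from `1`), but not in the highest level; no
condition if `j = 0`. -/
def Reached (j : ℕ) (e : Fin n) (x : State m n) : Prop :=
  j = 0 ∨ ∃ s, x s = e ∧ j ≤ s.1 + 1 ∧ (s.1 : ℕ) + 1 < h

theorem Top.reached_request {A : Finset (Fin n)} {x : State m n} (hA : Top A x)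
    (hm : #A ≤ totalSize m) {e k : Fin n} (he : e ∉ A) (hk : k ∈ A) {j : ℕ}
    (hj : Reached j e x) : Reached j e (request x k) := by
  rcases hj with hj | ⟨s, hs, hj⟩
  · exact Or.inl hj
  · refine Or.inr ⟨s, ?_, hj⟩
    rw [hA.request_apply_of_le hm hk, hs]
    by_contra hlt
    exact he (hs ▸ hA s (not_le.1 hlt))

/-- The alternative depends on where `e` lands. At rank at most `#A`, the items of `A` are pushed
back by at most one place and `e` joins them. At a larger rank, the first `#A` positions are
untouched and `e` has climbed one level, or has entered the lowest one after a miss. -/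
theorem Top.request_notMem [NeZero h] {A : Finset (Fin n)} {x : State m n} (hA : Top A x)
    {e : Fin n} (he : e ∉ A) {j : ℕ} (hj : Reached j e x) :
    Top (insert e A) (request x e) ∨
      (Top A (request x e) ∧ Reached (j + 1) e (request x e)) := by
  have hpos := NeZero.pos h
  by_cases hit : ∃ s, x s = e
  · obtain ⟨s, hs⟩ := hit
    have hsA : #A ≤ s.rank := by
      by_contra hlt
      exact he (hs ▸ hA s (not_le.1 hlt))
    by_cases hd : (landing s).rank ≤ #A
    · left
      intro t ht
      rw [card_insert_of_notMem he] at ht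
      rw [request_of_hit hs, mem_insert]
      by_cases hts : t = landing s
      · left
        rw [hts, hitSource_landing, hs]
      · right
        apply hA
        rcases hitSource_eq_or s t hts with ⟨e, _⟩ | ⟨e, -⟩
        · rw [e]; omega
        · omega
    · right
      have hlv : (s.1 : ℕ) + 1 < h := by
        by_contra hlv
        rw [rank_landing_of_top hlv] at hd
        omega
      refine ⟨fun t ht => ?_, Or.inr ⟨landing s, ?_, ?_, ?_⟩⟩
      · rw [request_of_hit hs]
        rcases hitSource_eq_or s t (by rintro rfl; omega) with ⟨e, -⟩ | ⟨-, e, -⟩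
        · rw [e]; exact hA t ht
        · omega
      · rw [request_of_hit hs, hitSource_landing, hs]
      · rw [level_landing hlv]
        rcases hj with rfl | ⟨s', hs', hj, -⟩
        · omega
        · obtain rfl : s' = s := x.injective (hs'.trans hs.symm)
          omega
      -- The first position of the highest level has rank zero, which is not larger than `#A`.
      · by_contra htop
        have := above_eq_zero (m := m) htop
        have h2 := landing_snd s
        unfold Slot.rank at hd
        omega
  · have hj0 : j = 0 := by
      rcases hj with hj | ⟨s, hs, -⟩
      · exact hj
      · exact absurd ⟨s, hs⟩ hit
    subst hj0
    set d : Slot m := ⟨⟨0, hpos⟩, ⟨0, (m _).pos⟩⟩ with hdef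
    have hreq : request x e d = e := by simp [request_of_miss hit, missContent, hdef]
    have hlow : ∀ t : Slot m, (t.1 : ℕ) = 0 → t.rank = d.rank + t.2 := by
      intro t ht
      have : t.1 = ⟨0, hpos⟩ := Fin.ext ht
      have := congrArg (above m) this
      have hd2 : (d.2 : ℕ) = 0 := rfl
      rw [Slot.rank, Slot.rank, this, hd2, add_zero]
    have hhigh : ∀ t : Slot m, (t.1 : ℕ) ≠ 0 → t.rank < d.rank := by
      intro t ht
      exact rank_lt_of_level_lt (by simp only [hdef, Fin.lt_def]; omega)
    by_cases hd : d.rank ≤ #A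
    · left
      intro t ht
      rw [card_insert_of_notMem he] at ht
      rw [request_of_miss hit, mem_insert]
      unfold missContent
      split_ifs with h1 h2
      · exact Or.inl rfl
      · have := rank_before h2
        exact Or.inr (hA _ (by omega))
      · have := hhigh t h1
        exact Or.inr (hA _ (by omega))
    · right
      refine ⟨fun t ht => ?_, Or.inr ⟨d, hreq, by simp [hdef], ?_⟩⟩
      · have h1 : (t.1 : ℕ) ≠ 0 := fun h1 => by
          have := hlow t h1
          omega
        rw [request_of_miss hit]
        simp only [missContent, h1, if_false]
        exact hA t ht
      · by_contra htop
        have := above_eq_zero (m := m) htop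
        have h2 : (d.2 : ℕ) = 0 := rfl
        unfold Slot.rank at hd
        omega

end Top

/-! ### Request patterns

A pattern is a list of pairs `(a, b)`: wait for a request of item `a`, while requests of items
smaller than `b` may occur. -/

section Pattern

variable {h n : ℕ} {m : Fin h → ℕ+}

/-- Every request sequence that follows the pattern leads from `x` to a state with property `Q`. -/
def Leads (Q : State m n → Prop) : List (ℕ × ℕ) → State m n → Prop
  | [], x => Q x
  | c :: l, x => ∀ w : List (Fin n), (∀ k ∈ w, (k : ℕ) < c.2) → ∀ k : Fin n, (k : ℕ) = c.1 →
      Leads Q l (request (w.foldl request x) k)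

theorem Leads.mono {Q Q' : State m n → Prop} (hQ : ∀ x, Q x → Q' x) {l : List (ℕ × ℕ)}
    {x : State m n} (hx : Leads Q l x) : Leads Q' l x := by
  induction l generalizing x with
  | nil => exact hQ x hx
  | cons c l ih => exact fun w hw k hk => ih (hx w hw k hk)

theorem Leads.append {Q Q' : State m n → Prop} {l l' : List (ℕ × ℕ)} {x : State m n}
    (hx : Leads Q l x) (hQ : ∀ x, Q x → Leads Q' l' x) : Leads Q' (l ++ l') x := by
  induction l generalizing x with
  | nil => exact hQ x hx
  | cons c l ih => exact fun w hw k hk => ih (hx w hw k hk)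

/-- Used to carry a whole nested family of `Top` conditions through one pattern, arguing for each
set separately. -/
theorem leads_forall {ι : Sort*} {Q : ι → State m n → Prop} {l : List (ℕ × ℕ)} {x : State m n}
    (hx : ∀ i, Leads (Q i) l x) : Leads (fun x => ∀ i, Q i x) l x := by
  induction l generalizing x with
  | nil => exact hx
  | cons c l ih => exact fun w hw k hk => ih fun i => hx i w hw k hk

/-- The `j` most popular items. -/
def popular (n j : ℕ) : Finset (Fin n) := univ.filter fun k => (k : ℕ) < j

theorem mem_popular {j : ℕ} {k : Fin n} : k ∈ popular n j ↔ (k : ℕ) < j := by simp [popular]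

theorem popular_mono {i j : ℕ} (hij : i ≤ j) : popular n i ⊆ popular n j := fun _ hk =>
  mem_popular.2 ((mem_popular.1 hk).trans_le hij)

theorem card_popular {j : ℕ} (hj : j ≤ n) : #(popular n j) = j := by
  rw [← card_map Fin.valEmbedding]
  convert card_range j
  ext k
  simp only [mem_map, mem_popular, Fin.valEmbedding_apply, mem_range]
  exact ⟨fun ⟨a, ha, e⟩ => e ▸ ha, fun hk => ⟨⟨k, hk.trans_le hj⟩, hk, rfl⟩⟩

theorem card_le_totalSize (hmn : totalSize m < n)
    {A : Finset (Fin n)} (hA : A ⊆ popular n (totalSize m)) :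
    #A ≤ totalSize m :=
  (card_le_card hA).trans (card_popular hmn.le).le

theorem leads_replicate_of_mem (hmn : totalSize m < n)
    {A : Finset (Fin n)} (hA : A ⊆ popular n (totalSize m)) {a b : ℕ}
    (hb : popular n b ⊆ A) (ha : ∀ k : Fin n, (k : ℕ) = a → k ∈ A) (r : ℕ) {x : State m n}
    (hx : Top A x) : Leads (Top A) (List.replicate r (a, b)) x := by
  have hm := card_le_totalSize hmn hA
  induction r generalizing x with
  | zero => exact hx
  | succ r ih =>
    intro w hw k hk
    refine ih (Top.request_mem ?_ hm (ha k hk))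
    clear ih
    induction w generalizing x with
    | nil => exact hx
    | cons k' w ihw =>
      exact ihw (hx.request_mem hm (hb (mem_popular.2 (hw k' (by simp)))))
        fun k hk => hw k (by simp [hk])

/-- Tolerated requests lie in `A` and act only on ranks below `#A`, so they do not undo the climb of
`e`; each request of `e` adds one to `j` unless `e` has already joined `A`. -/
theorem leads_replicate_of_notMem (hmn : totalSize m < n)
    [NeZero h] {A : Finset (Fin n)} {e : Fin n} (he : e ∉ A)
    (hA : insert e A ⊆ popular n (totalSize m)) {b : ℕ} (hb : popular n b ⊆ A) (r : ℕ) {j : ℕ}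
    {x : State m n} (hx : Top (insert e A) x ∨ Top A x ∧ Reached j e x) :
    Leads (fun x => Top (insert e A) x ∨ Top A x ∧ Reached (j + r) e x)
      (List.replicate r ((e : ℕ), b)) x := by
  have hm := card_le_totalSize hmn ((subset_insert e A).trans hA)
  have hm' := card_le_totalSize hmn hA
  induction r generalizing x j with
  | zero => exact hx
  | succ r ih =>
    intro w hw k hk
    obtain rfl : k = e := Fin.ext hk
    have hw' : Top (insert k A) (w.foldl request x) ∨
        Top A (w.foldl request x) ∧ Reached j k (w.foldl request x) := by
      clear ih
      induction w generalizing x with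
      | nil => exact hx
      | cons k' w ihw =>
        have hk' : k' ∈ A := hb (mem_popular.2 (hw k' (by simp)))
        refine ihw ?_ fun k hk => hw k (by simp [hk])
        rcases hx with hx | ⟨hx, hj⟩
        · exact Or.inl (hx.request_mem hm' (mem_insert_of_mem hk'))
        · exact Or.inr ⟨hx.request_mem hm hk', hx.reached_request hm he hk' hj⟩
    have hstep : Top (insert k A) (request (w.foldl request x) k) ∨
        Top A (request (w.foldl request x) k) ∧
          Reached (j + 1) k (request (w.foldl request x) k) := by
      rcases hw' with hx | ⟨hx, hj⟩
      · exact Or.inl (hx.request_mem hm' (mem_insert_self k A))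
      · exact hx.request_notMem he hj
    have := ih (j := j + 1) hstep
    rwa [add_right_comm] at this

/-- If `A` fills the top of the cache, then `h` requests of item `e`, mixed with requests of items
in `A`, bring `insert e A` to the top. -/
theorem leads_insert (hmn : totalSize m < n) [NeZero h] {A : Finset (Fin n)} {e : Fin n}
    (hA : insert e A ⊆ popular n (totalSize m)) {b : ℕ} (hb : popular n b ⊆ A) {x : State m n}
    (hx : Top A x) : Leads (Top (insert e A)) (List.replicate h ((e : ℕ), b)) x := by
  by_cases he : e ∈ A
  · rw [insert_eq_of_mem he] at hA ⊢
    exact leads_replicate_of_mem hmn hA hb (fun k hk => by rwa [Fin.ext hk]) h hx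
  · refine (leads_replicate_of_notMem hmn he hA hb h (j := 0) (Or.inr ⟨hx, Or.inl rfl⟩)).mono ?_
    -- After `h` requests the second alternative would put `e` in level `h` or higher but below the
    -- highest level, which is impossible.
    rintro y (hy | ⟨-, hy | ⟨s, -, h1, h2⟩⟩)
    · exact hy
    · exact absurd hy (by simpa using NeZero.ne h)
    · omega

/-- The pattern that brings the `r` most popular items to the top. -/
def gather (h : ℕ) : ℕ → List (ℕ × ℕ)
  | 0 => []
  | r + 1 => gather h r ++ List.replicate h (r, r)

/-- The pattern that brings the `c` most popular items to the top and puts the items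
`e, …, e + d - 1` behind them. -/
def arrange (h c : ℕ) : ℕ → ℕ → List (ℕ × ℕ)
  | _, 0 => gather h c
  | e, d + 1 => arrange h c (e + 1) d ++ (List.replicate h (e, c) ++ gather h c)

/-- The pattern that sorts the `r` most popular items at the top. -/
def finish (h : ℕ) : ℕ → List (ℕ × ℕ)
  | 0 => []
  | r + 1 => gather h r ++ finish h r

theorem leads_gather (hmn : totalSize m < n)
    [NeZero h] {r : ℕ} (hr : r ≤ totalSize m) (x : State m n) :
    Leads (Top (popular n r)) (gather h r) x := by
  induction r generalizing x with
  | zero => intro t ht; simp [popular] at ht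
  | succ r ih =>
    refine (ih (by omega) x).append fun y hy => ?_
    have hins : popular n (r + 1) = insert (⟨r, by omega⟩ : Fin n) (popular n r) := by
      ext k
      simp only [mem_popular, mem_insert, Fin.ext_iff]
      omega
    rw [hins]
    exact leads_insert hmn (hins ▸ popular_mono hr) subset_rfl hy

theorem leads_gather_of_subset (hmn : totalSize m < n)
    {A : Finset (Fin n)} (hA : A ⊆ popular n (totalSize m)) {r : ℕ}
    (hr : popular n r ⊆ A) {x : State m n} (hx : Top A x) : Leads (Top A) (gather h r) x := by
  induction r generalizing x with
  | zero => exact hx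
  | succ r ih =>
    have hr' := (popular_mono (n := n) (Nat.le_succ r)).trans hr
    exact (ih hr' hx).append fun y hy => leads_replicate_of_mem hmn hA hr'
      (fun k hk => hr (mem_popular.2 (by omega))) h hy

/-- The rarer items are inserted in decreasing order of index, each in front of the later ones:
adding `e` turns the sets for `e + 1` into those for `e`. The set with `i = e` is just `popular n
c`, which the final `gather` restores without disturbing the others. Each rarer item is thus asked
for only `h` times. -/
theorem leads_arrange (hmn : totalSize m < n) [NeZero h] {c : ℕ} (d : ℕ) {e : ℕ} (hce : c ≤ e)
    (hed : e + d = totalSize m) (x : State m n) :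
    Leads (fun x => ∀ i, e ≤ i → i ≤ totalSize m →
      Top (univ.filter fun k : Fin n => (k : ℕ) < c ∨ e ≤ k ∧ (k : ℕ) < i) x)
      (arrange h c e d) x := by
  induction d generalizing e x with
  | zero =>
    refine (leads_gather hmn (by omega) x).mono fun y hy i hi hi' => ?_
    convert hy using 1
    ext k
    simp only [mem_filter, mem_univ, true_and, mem_popular]
    omega
  | succ d ih =>
    refine (ih (by omega) (by omega) x).append fun y hy => ?_
    refine leads_forall fun i => leads_forall fun hi => leads_forall fun hi' => ?_
    have hsub : (univ.filter fun k : Fin n => (k : ℕ) < c ∨ e ≤ k ∧ (k : ℕ) < i) ⊆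
        popular n (totalSize m) := fun k hk => by
      simp only [mem_filter, mem_univ, true_and, mem_popular] at hk ⊢
      omega
    have hsub' : popular n c ⊆ univ.filter fun k : Fin n => (k : ℕ) < c ∨ e ≤ k ∧ (k : ℕ) < i :=
      fun k hk => by
        simp only [mem_filter, mem_univ, true_and, mem_popular] at hk ⊢
        omega
    rcases hi.eq_or_lt with rfl | hlt
    · have heq : (univ.filter fun k : Fin n => (k : ℕ) < c ∨ e ≤ k ∧ (k : ℕ) < e) =
          popular n c := by
        ext k
        simp only [mem_filter, mem_univ, true_and, mem_popular]
        omega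
      rw [heq]
      -- Nothing needs to be kept during the requests of `e`, since `gather` works from any state.
      have htriv : Leads (fun _ => True) (List.replicate h (e, c)) y := by
        have : ∀ (l : List (ℕ × ℕ)) (y : State m n), Leads (fun _ => True) l y := by
          intro l
          induction l with
          | nil => exact fun _ => trivial
          | cons c l ih => exact fun y w _ k _ => ih _
        exact this _ y
      exact htriv.append fun z _ => leads_gather hmn (by omega) z
    · have hins : (univ.filter fun k : Fin n => (k : ℕ) < c ∨ e ≤ k ∧ (k : ℕ) < i) =
          insert (⟨e, by omega⟩ : Fin n)
            (univ.filter fun k : Fin n => (k : ℕ) < c ∨ e + 1 ≤ k ∧ (k : ℕ) < i) := by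
        ext k
        simp only [mem_filter, mem_univ, true_and, mem_insert, Fin.ext_iff]
        omega
      have hstep : Leads (Top (univ.filter fun k : Fin n => (k : ℕ) < c ∨ e ≤ k ∧ (k : ℕ) < i))
          (List.replicate h (e, c)) y := by
        rw [hins]
        refine leads_insert hmn (hins ▸ hsub) (fun k hk => ?_) (hy i hlt hi')
        simp only [mem_filter, mem_univ, true_and, mem_popular] at hk ⊢
        omega
      exact hstep.append fun z hz => leads_gather_of_subset hmn hsub hsub' hz

/-- Gathering the `r` most popular items preserves `Top` for every larger initial segment, so
descending `r` adds one segment at a time. -/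
theorem leads_finish (hmn : totalSize m < n)
    [NeZero h] {r : ℕ} (hr : r ≤ totalSize m) {x : State m n}
    (hx : ∀ i, r ≤ i → i ≤ totalSize m → Top (popular n i) x) :
    Leads (fun x => ∀ i ≤ totalSize m, Top (popular n i) x) (finish h r) x := by
  induction r generalizing x with
  | zero => exact fun i hi => hx i (Nat.zero_le i) hi
  | succ r ih =>
    refine Leads.append (Q := fun x => ∀ i, r ≤ i → i ≤ totalSize m → Top (popular n i) x) ?_
      fun y hy => ih (by omega) hy
    refine leads_forall fun i => leads_forall fun hi => leads_forall fun hi' => ?_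
    rcases hi.eq_or_lt with rfl | hlt
    · exact leads_gather hmn (by omega) x
    · exact leads_gather_of_subset hmn (popular_mono hi') (popular_mono hi) (hx i hlt hi')

/-- The state in which the most popular items occupy the cache in order. -/
def sorted (hmn : totalSize m < n) : State m n :=
  ⟨fun t => ⟨t.rank, (rank_lt_totalSize t).trans hmn⟩,
    fun s t hst => rank_injective (by simpa using hst)⟩

/-- The item at rank `r` has index at most `r`, and by induction the smaller indices already sit at
smaller ranks. -/
theorem eq_sorted (hmn : totalSize m < n)
    {x : State m n} (hx : ∀ i ≤ totalSize m, Top (popular n i) x) :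
    x = sorted hmn := by
  have key : ∀ r, ∀ t : Slot m, t.rank = r → (x t : ℕ) = r := by
    intro r
    induction r using Nat.strong_induction_on with
    | _ r ih =>
      intro t ht
      have hlt := rank_lt_totalSize t
      have h1 := mem_popular.1 (hx (r + 1) (by omega) t (by rw [card_popular] <;> omega))
      by_contra hne
      obtain ⟨s, hs⟩ := exists_rank_eq (m := m) (r := (x t : ℕ)) (by omega)
      have h2 := ih (x t) (by omega) s hs
      have : s = t := x.injective (Fin.ext h2)
      subst this
      omega
  ext t
  exact key _ t rfl

/-- The pattern after which the cache is sorted, whatever its state was. -/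
theorem leads_sorted (hmn : totalSize m < n)
    [NeZero h] {c : ℕ} (hc : c ≤ totalSize m) (x : State m n) :
    Leads (· = sorted hmn) (arrange h c c (totalSize m - c) ++ finish h c) x := by
  refine (leads_arrange hmn (totalSize m - c) le_rfl (by omega) x).append fun y hy => ?_
  refine (leads_finish hmn hc fun i hi hi' => ?_).mono fun z hz => eq_sorted hmn hz
  convert hy i hi hi' using 1
  ext k
  simp only [mem_filter, mem_univ, true_and, mem_popular]
  omega

end Pattern

/-! ### Time until a pattern is completed -/

section Monitor

variable {h n : ℕ} {m : Fin h → ℕ+} {p : Fin n → ℝ}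

/-- The total probability of all but the `b` most popular items. -/
noncomputable def tail (p : Fin n → ℝ) (b : ℕ) : ℝ := 1 - ∑ k ∈ popular n b, p k

/-- The probability that item `c.1` is requested before any other item outside the `c.2` most
popular ones. -/
noncomputable def odds (p : Fin n → ℝ) (c : ℕ × ℕ) : ℝ := prob p (c.1 + 1) / tail p c.2

/-- Patterns number items from 0, `prob` from 1. -/
theorem prob_succ (k : Fin n) : prob p (k + 1) = p k := by
  rw [prob, dif_pos ⟨by omega, by omega⟩]
  rfl

theorem tail_eq_sum (hp1 : ∑ k, p k = 1) (b : ℕ) : tail p b = ∑ k ∈ (popular n b)ᶜ, p k := by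
  rw [tail, ← hp1, ← sum_add_sum_compl (popular n b) p, add_sub_cancel_left]

theorem tail_anti (hp : ∀ k, 0 < p k) {b c : ℕ} (hbc : b ≤ c) : tail p c ≤ tail p b :=
  sub_le_sub_left (sum_le_sum_of_subset_of_nonneg (popular_mono hbc) fun k _ _ => (hp k).le) _

theorem le_tail (hp : ∀ k, 0 < p k) (hp1 : ∑ k, p k = 1) {b : ℕ} (k : Fin n) (hk : b ≤ k) :
    p k ≤ tail p b := by
  rw [tail_eq_sum hp1]
  exact single_le_sum (fun i _ => (hp i).le) (by simpa [mem_popular] using hk)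

theorem tail_le_mul (hp1 : ∑ k, p k = 1) {b : ℕ} {u : ℝ} (hu0 : 0 ≤ u)
    (hu : ∀ k : Fin n, b ≤ k → p k ≤ u) : tail p b ≤ n * u := by
  rw [tail_eq_sum hp1]
  calc ∑ k ∈ (popular n b)ᶜ, p k ≤ #(popular n b)ᶜ • u :=
        sum_le_card_nsmul _ _ _ fun k hk => hu k (by simpa [mem_popular] using hk)
    _ ≤ n * u := by
        rw [nsmul_eq_mul]
        have : #(popular n b)ᶜ ≤ n := by simpa using card_le_univ (popular n b)ᶜ
        gcongr

theorem tail_le_add {b c : ℕ} (hbc : b ≤ c) (hcn : c ≤ n) {u : ℝ} (hu0 : 0 ≤ u)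
    (hu : ∀ k : Fin n, b ≤ k → (k : ℕ) < c → p k ≤ u) : tail p b ≤ c * u + tail p c := by
  have hs := sum_sdiff (f := p) (popular_mono (n := n) hbc)
  have : ∑ k ∈ popular n c \ popular n b, p k ≤ c * u := by
    calc ∑ k ∈ popular n c \ popular n b, p k ≤ #(popular n c \ popular n b) • u :=
          sum_le_card_nsmul _ _ _ fun k hk => by
            simp only [mem_sdiff, mem_popular, not_lt] at hk
            exact hu k hk.2 hk.1
      _ ≤ c * u := by
          rw [nsmul_eq_mul]
          have : #(popular n c \ popular n b) ≤ c :=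
            (card_le_card sdiff_subset).trans (card_popular hcn).le
          gcongr
  unfold tail
  linarith

/-- The patterns whose entries `c` satisfy `c.2 ≤ c.1 < n` and `q ≤ tail p c.2`. -/
abbrev Pattern (p : Fin n → ℝ) (q : ℝ) : Type :=
  {l : List (ℕ × ℕ) // ∀ c ∈ l, c.2 ≤ c.1 ∧ c.1 < n ∧ q ≤ tail p c.2}

variable {q : ℝ}

/-- What remains of the pattern `l` after a request of item `k`; a request that does not fit leads
back to the full pattern. -/
def advance (full : Pattern p q) : Pattern p q → Fin n → Pattern p q
  | ⟨[], hl⟩, _ => ⟨[], hl⟩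
  | ⟨c :: l, hl⟩, k =>
    if (k : ℕ) = c.1 then ⟨l, fun c hc => hl c (List.mem_cons_of_mem _ hc)⟩
    else if (k : ℕ) < c.2 then ⟨c :: l, hl⟩ else full

theorem odds_pos (hp : ∀ k, 0 < p k) (hq : 0 < q) {c : ℕ × ℕ} (hc : c.1 < n ∧ q ≤ tail p c.2) :
    0 < odds p c := by
  have := prob_succ (p := p) ⟨c.1, hc.1⟩
  rw [odds, this]
  exact div_pos (hp _) (hq.trans_le hc.2)

theorem odds_le_one (hp : ∀ k, 0 < p k) (hp1 : ∑ k, p k = 1) (hq : 0 < q) {c : ℕ × ℕ}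
    (hc : c.2 ≤ c.1 ∧ c.1 < n ∧ q ≤ tail p c.2) : odds p c ≤ 1 := by
  have := prob_succ (p := p) ⟨c.1, hc.2.1⟩
  rw [odds, this, div_le_one (hq.trans_le hc.2.2)]
  exact le_tail hp hp1 _ hc.1

theorem prod_odds_pos (hp : ∀ k, 0 < p k) (hq : 0 < q) (l : Pattern p q) :
    0 < (l.1.map (odds p)).prod := by
  refine List.prod_pos fun a ha => ?_
  obtain ⟨c, hc, rfl⟩ := List.mem_map.1 ha
  exact odds_pos hp hq (l.2 c hc).2

theorem prod_odds_le_one (hp : ∀ k, 0 < p k) (hp1 : ∑ k, p k = 1) (hq : 0 < q)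
    (l : List (ℕ × ℕ)) (hl : ∀ c ∈ l, c.2 ≤ c.1 ∧ c.1 < n ∧ q ≤ tail p c.2) :
    (l.map (odds p)).prod ≤ 1 := by
  induction l with
  | nil => simp
  | cons c l ih =>
    rw [List.map_cons, List.prod_cons]
    have hl' := fun c hc => hl c (List.mem_cons_of_mem _ hc)
    exact mul_le_one₀ (odds_le_one hp hp1 hq (hl c (by simp)))
      (prod_odds_pos hp hq ⟨l, hl'⟩).le (ih hl')

/-- An upper bound for the expected time to complete a pattern, starting with the remainder `l`,
if the expected time for the full pattern is at most `v`. -/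
noncomputable def potential (v : ℝ) (l : Pattern p q) : ℝ :=
  v * (1 - (l.1.map (odds p)).prod) + l.1.length / q

/-- A restart is taken as the default outcome and corrected on two events, the awaited request and a
tolerated one; these are disjoint because `c.2 ≤ c.1`. -/
theorem sum_mul_advance (hp1 : ∑ k, p k = 1) (full : Pattern p q) (V : Pattern p q → ℝ)
    {c : ℕ × ℕ} {l : List (ℕ × ℕ)}
    (hl : ∀ d ∈ c :: l, d.2 ≤ d.1 ∧ d.1 < n ∧ q ≤ tail p d.2) :
    ∑ k, p k * V (advance full ⟨c :: l, hl⟩ k) =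
      V full + prob p (c.1 + 1) * (V ⟨l, fun c hc => hl c (List.mem_cons_of_mem _ hc)⟩ - V full)
        + (1 - tail p c.2) * (V ⟨c :: l, hl⟩ - V full) := by
  obtain ⟨hc1, hc2, -⟩ := hl c (by simp)
  have hsum : ∀ k : Fin n, p k * V (advance full ⟨c :: l, hl⟩ k) =
      p k * V full
        + (if k = ⟨c.1, hc2⟩ then
            p k * (V ⟨l, fun c hc => hl c (List.mem_cons_of_mem _ hc)⟩ - V full) else 0)
        + (if k ∈ popular n c.2 then p k * (V ⟨c :: l, hl⟩ - V full) else 0) := by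
    intro k
    have hiff : k = ⟨c.1, hc2⟩ ↔ (k : ℕ) = c.1 := Fin.ext_iff
    simp only [advance, hiff, mem_popular]
    split_ifs with h1 h2
    · omega
    · ring
    · ring
    · ring
  rw [sum_congr rfl fun k _ => hsum k, sum_add_distrib, sum_add_distrib, ← sum_mul, hp1, one_mul,
    sum_ite_eq' univ, if_pos (mem_univ _), sum_ite_mem, univ_inter, ← sum_mul, tail,
    ← prob_succ (p := p) ⟨c.1, hc2⟩]
  ring

/-- With `T` the tail and `o` the odds of the first entry, `F` the potential of the full pattern and
`L = l.length / q` for the entries after the first, the surplus of the right side is `T (1 - o) (v -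
F) + T (1 - o) L + (T / q - 1)`. The odds products cancel and every term is nonnegative. -/
theorem one_add_sum_potential_le (hp : ∀ k, 0 < p k) (hp1 : ∑ k, p k = 1) (hq : 0 < q)
    {v : ℝ} (full : Pattern p q) (hfull : potential v full ≤ v) (l : Pattern p q)
    (hl : l.1 ≠ []) : 1 + ∑ k, p k * potential v (advance full l k) ≤ potential v l := by
  obtain ⟨_ | ⟨c, l⟩, hl'⟩ := l
  · exact absurd rfl hl
  rw [sum_mul_advance hp1 full _ hl']
  obtain ⟨hc1, hc2, hc3⟩ := hl' c (by simp)
  have hT : 0 < tail p c.2 := hq.trans_le hc3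
  have hodds : prob p (c.1 + 1) = odds p c * tail p c.2 := by
    rw [odds, div_mul_cancel₀ _ hT.ne']
  have ho1 := odds_le_one hp hp1 hq (hl' c (by simp))
  have ho0 := odds_pos hp hq (hl' c (by simp)).2
  have hT1 : 1 ≤ tail p c.2 / q := by rwa [one_le_div hq]
  have hlen : (0 : ℝ) ≤ l.length / q := by positivity
  rw [hodds]
  set F := potential v full
  simp only [potential, List.map_cons, List.prod_cons, List.length_cons, Nat.cast_add,
    Nat.cast_one]
  set Θ := (l.map (odds p)).prod
  set o := odds p c
  set T := tail p c.2
  set L : ℝ := l.length / q with hL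
  have hL1 : ((l.length : ℝ) + 1) / q = L + 1 / q := by rw [hL]; ring
  have hTq : T / q = T * (1 / q) := by ring
  rw [hL1]
  have h1 : 0 ≤ T * (1 - o) * (v - F) :=
    mul_nonneg (mul_nonneg hT.le (by linarith)) (by linarith)
  have h2 : 0 ≤ T * (1 - o) * L := mul_nonneg (mul_nonneg hT.le (by linarith)) hlen
  nlinarith

theorem leads_advance {Q : State m n → Prop} (full : Pattern p q)
    (hfull : ∀ x : State m n, Leads Q full.1 x) (l : Pattern p q) (x : State m n) (k : Fin n)
    (hl : l.1 ≠ []) (hx : Leads Q l.1 x) : Leads Q (advance full l k).1 (request x k) := by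
  obtain ⟨_ | ⟨c, l⟩, hl'⟩ := l
  · exact absurd rfl hl
  simp only [advance]
  split_ifs with h1 h2
  · exact hx [] (by simp) k h1
  · intro w hw k' hk'
    refine hx (k :: w) (fun i hi => ?_) k' hk'
    rcases List.mem_cons.1 hi with rfl | hi
    · exact h2
    · exact hw i hi
  -- A misfit may leave any state behind, but the full pattern works from every state.
  · exact hfull _

/-- If a pattern leads from every state to the same state, then the chain mixes in the time needed
to complete it. -/
theorem exists_minorization_of_leads (hp : ∀ k, 0 < p k) (hp1 : ∑ k, p k = 1) (hq : 0 < q)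
    (full : Pattern p q) {z : State m n} (hfull : ∀ x : State m n, Leads (· = z) full.1 x) :
    ∃ t : ℕ, (t : ℝ) ≤ 2 * (full.1.length / (q * (full.1.map (odds p)).prod)) ∧
      ∃ s : State m n → ℝ, 1 / 2 ≤ ∑ y, s y ∧ ∀ x y, s y ≤ (transition m p ^ t) x y := by
  have hΘ := prod_odds_pos hp hq full
  -- This is the value for which `potential v full = v`, as the drift estimate needs.
  set v : ℝ := full.1.length / (q * (full.1.map (odds p)).prod) with hv
  have hv0 : 0 ≤ v := by positivity
  have hVfull : potential v full = v := by
    rw [potential, hv]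
    field_simp
    ring
  -- Twice the mean bound: `t + 1` exceeds `2 * v`, so Markov's inequality leaves survival at most
  -- 1/2.
  refine ⟨⌊2 * v⌋₊, Nat.floor_le (by positivity), ?_⟩
  set t := ⌊2 * v⌋₊
  have ht : 2 * v < t + 1 := Nat.lt_floor_add_one _
  obtain ⟨s, -, hs1, hs2⟩ := exists_minorization (m := m) (advance full)
    (fun l : Pattern p q => l.1 = []) hp hp1 (inv := fun l x => Leads (· = z) l.1 x)
    (fun l x k hl hx => leads_advance full hfull l x k hl hx) (z := z)
    (fun l x hl hx => by rw [hl] at hx; exact hx) t full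
  refine ⟨s, ?_, fun x y => hs2 x (hfull x) y⟩
  have hsurv := survival_mul_le (advance full) (fun l : Pattern p q => l.1 = []) hp hp1
    (V := potential v)
    (fun l => add_nonneg (mul_nonneg hv0 (sub_nonneg.2 (prod_odds_le_one hp hp1 hq _ l.2)))
      (by positivity))
    (fun l hl => one_add_sum_potential_le hp hp1 hq full hVfull.le l hl) t full
  rw [hVfull] at hsurv
  have hnn := survival_nonneg (advance full) (fun l : Pattern p q => l.1 = []) hp t full
  set u := survival p (advance full) (fun l : Pattern p q => l.1 = []) t full
  have : u ≤ 1 / 2 := by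
    by_contra hlt
    rw [not_le] at hlt
    have : (0 : ℝ) < t + 1 := by positivity
    nlinarith
  linarith

end Monitor

/-! ### Length and probability of the sorting pattern -/

section Cost

variable {h n : ℕ} {m : Fin h → ℕ+} {p : Fin n → ℝ}

theorem length_gather (h r : ℕ) : (gather h r).length = h * r := by
  induction r with
  | zero => rfl
  | succ r ih => simp [gather, ih, mul_add]

theorem length_arrange (h c d e : ℕ) :
    (arrange h c e d).length = h * c + d * (h + h * c) := by
  induction d generalizing e with
  | zero => simp [arrange, length_gather]
  | succ d ih =>
    simp only [arrange, List.length_append, ih, List.length_replicate, length_gather]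
    ring

theorem length_finish_le (h : ℕ) {r N : ℕ} (hr : r ≤ N) : (finish h r).length ≤ r * (h * N) := by
  induction r with
  | zero => simp [finish]
  | succ r ih =>
    have h1 := ih (by omega)
    have h2 : h * r ≤ h * N := Nat.mul_le_mul_left h (by omega)
    simp only [finish, List.length_append, length_gather]
    linarith

theorem mem_gather {h r : ℕ} {c : ℕ × ℕ} (hc : c ∈ gather h r) : c.2 = c.1 ∧ c.1 < r := by
  induction r with
  | zero => simp [gather] at hc
  | succ r ih =>
    rw [gather, List.mem_append, List.mem_replicate] at hc
    rcases hc with hc | ⟨-, rfl⟩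
    · have := ih hc
      exact ⟨this.1, by omega⟩
    · exact ⟨rfl, Nat.lt_succ_self r⟩

theorem mem_finish {h r : ℕ} {c : ℕ × ℕ} (hc : c ∈ finish h r) : c.2 = c.1 ∧ c.1 < r := by
  induction r with
  | zero => simp [finish] at hc
  | succ r ih =>
    rw [finish, List.mem_append] at hc
    rcases hc with hc | hc
    · have := mem_gather hc
      exact ⟨this.1, by omega⟩
    · have := ih hc
      exact ⟨this.1, by omega⟩

theorem mem_arrange {h r d e : ℕ} {c : ℕ × ℕ} (hc : c ∈ arrange h r e d) :
    (c.2 = c.1 ∧ c.1 < r) ∨ (c.2 = r ∧ e ≤ c.1 ∧ c.1 < e + d) := by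
  induction d generalizing e with
  | zero => exact Or.inl (mem_gather hc)
  | succ d ih =>
    rw [arrange, List.mem_append, List.mem_append, List.mem_replicate] at hc
    rcases hc with hc | ⟨-, rfl⟩ | hc
    · rcases ih hc with h1 | ⟨h1, h2, h3⟩
      · exact Or.inl h1
      · exact Or.inr ⟨h1, by omega, by omega⟩
    · exact Or.inr ⟨rfl, le_rfl, by simp⟩
    · exact Or.inl (mem_gather hc)

theorem pow_length_le_prod_map {α : Type} {f : α → ℝ} {κ : ℝ} (hκ : 0 ≤ κ) (l : List α)
    (hl : ∀ c ∈ l, κ ≤ f c) : κ ^ l.length ≤ (l.map f).prod := by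
  induction l with
  | nil => simp
  | cons c l ih =>
    rw [List.map_cons, List.prod_cons, List.length_cons, pow_succ']
    exact mul_le_mul (hl c (by simp)) (ih fun c hc => hl c (List.mem_cons_of_mem _ hc))
      (pow_nonneg hκ _) (hκ.trans (hl c (by simp)))

/-- Every entry costs a factor `κ`; only the `h` requests of each of the `d` rarer items cost `ρ` as
well. This keeps the power of `n` down to `h * d`. -/
theorem le_prod_odds_arrange {κ ρ : ℝ} (hκ : 0 ≤ κ) (hρ : 0 ≤ ρ) {c : ℕ}
    (hc : ∀ k < c, κ ≤ odds p (k, k)) (d : ℕ) {e : ℕ}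
    (he : ∀ k, e ≤ k → k < e + d → κ * ρ ≤ odds p (k, c)) :
    κ ^ (arrange h c e d).length * ρ ^ (h * d) ≤ ((arrange h c e d).map (odds p)).prod := by
  have hg : κ ^ (gather h c).length ≤ ((gather h c).map (odds p)).prod := by
    refine pow_length_le_prod_map hκ _ fun a ha => ?_
    obtain ⟨h1, h2⟩ := mem_gather ha
    have := hc a.1 h2
    rwa [show a = (a.1, a.1) from Prod.ext rfl h1]
  induction d generalizing e with
  | zero => simpa [arrange] using hg
  | succ d ih =>
    have h1 := ih (e := e + 1) fun k hk hk' => he k (by omega) (by omega)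
    have h2 : (κ * ρ) ^ h ≤ ((List.replicate h (e, c)).map (odds p)).prod := by
      refine (by simp : (κ * ρ) ^ h = _ ^ (List.replicate h (e, c)).length).le.trans
        (pow_length_le_prod_map (mul_nonneg hκ hρ) _ fun a ha => ?_)
      rw [List.eq_of_mem_replicate ha]
      exact he e le_rfl (by omega)
    simp only [arrange, List.map_append, List.prod_append, List.length_append]
    calc κ ^ ((arrange h c (e + 1) d).length +
            ((List.replicate h (e, c)).length + (gather h c).length)) * ρ ^ (h * (d + 1))
        = (κ ^ (arrange h c (e + 1) d).length * ρ ^ (h * d)) *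
            ((κ * ρ) ^ h * κ ^ (gather h c).length) := by
          rw [List.length_replicate]
          ring
      _ ≤ _ := by
          have : 0 ≤ κ * ρ := mul_nonneg hκ hρ
          have h3 : 0 ≤ κ ^ (arrange h c (e + 1) d).length * ρ ^ (h * d) := by positivity
          have h4 : 0 ≤ (κ * ρ) ^ h := by positivity
          exact mul_le_mul h1 (mul_le_mul h2 hg (by positivity) (h4.trans h2)) (by positivity)
            (h3.trans h1)

/-- A threshold `τ` splits the `N` most popular items into those of probability at least `τ` and
those of probability at most `τ`. -/
theorem exists_cutoff (hanti : Antitone p) (N : ℕ) (τ : ℝ) :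
    ∃ c ≤ N, (∀ k : Fin n, (k : ℕ) < c → τ ≤ p k) ∧
      ∀ k : Fin n, c ≤ k → (k : ℕ) < N → p k ≤ τ := by
  classical
  -- The cutoff is the first index with probability below `τ`, capped at `N`.
  have hex : ∃ c, c = N ∨ ∃ hc : c < n, p ⟨c, hc⟩ < τ := ⟨N, Or.inl rfl⟩
  refine ⟨Nat.find hex, Nat.find_min' hex (Or.inl rfl), fun k hk => ?_, fun k hk hkN => ?_⟩
  · have := Nat.find_min hex hk
    push Not at this
    exact this.2 k.isLt
  · rcases Nat.find_spec hex with h1 | ⟨h1, h2⟩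
    · omega
    · exact (hanti (a := ⟨_, h1⟩) (b := k) hk).trans h2.le

theorem tail_pos (hp : ∀ k, 0 < p k) (hp1 : ∑ k, p k = 1) {b : ℕ} (hb : b < n) :
    0 < tail p b := (hp ⟨b, hb⟩).trans_le (le_tail hp hp1 ⟨b, hb⟩ le_rfl)

/-- After `O(n ^ (h m) / (1 - σ))` steps, the rows of the transition matrix have a common part of
mass at least `1 / 2`. -/
theorem exists_minorization_time (hh : 1 ≤ h) (hmn : totalSize m < n) (hp : ∀ k, 0 < p k)
    (hp1 : ∑ k, p k = 1) (hanti : Antitone p) {N L : ℕ} (hN : N = totalSize m) (hN1 : 1 ≤ N)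
    (hL : L = h * N + N * (h + h * N) + N * (h * N)) :
    ∃ t : ℕ, (t : ℝ) ≤ 2 * (L * (N + 1) ^ L) * (n ^ (h * N) / tail p (N - 1)) ∧
      ∃ s : State m n → ℝ, 1 / 2 ≤ ∑ y, s y ∧ ∀ x y, s y ≤ (transition m p ^ t) x y := by
  have : NeZero h := ⟨by omega⟩
  have hNn : N < n := by omega
  have hn0 : (0 : ℝ) < n := by exact_mod_cast (by omega : 0 < n)
  -- Comparing with the mass beyond the first `N` items makes `κ` depend on `N` only.
  set τ := tail p N with hτ
  have hτ0 : 0 < τ := tail_pos hp hp1 hNn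
  have hq : 0 < tail p (N - 1) := tail_pos hp hp1 (by omega)
  obtain ⟨c, hcN, hc1, hc2⟩ := exists_cutoff hanti N τ
  set κ : ℝ := 1 / (N + 1) with hκ
  have hκ0 : 0 < κ := by positivity
  have hκ1 : κ ≤ 1 := by
    rw [hκ, div_le_one (by positivity)]
    linarith [(Nat.cast_nonneg N : (0 : ℝ) ≤ N)]
  -- Above the cutoff, `tail p k ≤ N * p k + τ ≤ (N + 1) * p k`.
  have hpop : ∀ k < c, κ ≤ odds p (k, k) := by
    intro k hk
    have hkn : k < n := by omega
    have h1 : tail p k ≤ N * p ⟨k, hkn⟩ + τ := tail_le_add (by omega) hNn.le (hp _).le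
      fun j hj _ => hanti (show (⟨k, hkn⟩ : Fin n) ≤ j from hj)
    have h2 := hc1 ⟨k, hkn⟩ hk
    have h3 := tail_pos hp hp1 hkn
    rw [odds, prob_succ (p := p) ⟨k, hkn⟩, hκ, div_le_div_iff₀ (by positivity) h3]
    linarith
  -- Below the cutoff, `tail p c ≤ (N + 1) * τ`, and `τ ≤ n * p k` because the items beyond `N` are
  -- rarer than `k`.
  have hflat : ∀ k, c ≤ k → k < c + (N - c) → κ * (1 / n) ≤ odds p (k, c) := by
    intro k hk hk'
    have hkn : k < n := by omega
    have h1 : tail p c ≤ N * τ + τ := tail_le_add hcN hNn.le hτ0.le hc2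
    have h2 : τ ≤ n * p ⟨k, hkn⟩ := tail_le_mul hp1 (hp _).le
      fun j hj => hanti (show (⟨k, hkn⟩ : Fin n) ≤ j from Fin.le_def.2 (by simp only; omega))
    have h3 := tail_pos hp hp1 (show c < n by omega)
    rw [odds, prob_succ (p := p) ⟨k, hkn⟩, hκ, one_div_mul_one_div,
      div_le_div_iff₀ (by positivity) h3]
    have h4 : (0 : ℝ) ≤ N + 1 := by positivity
    nlinarith [mul_le_mul_of_nonneg_left h2 h4]
  -- At most the `N - 1` most popular items are ever tolerated, so `q` can be `tail p (N - 1)`,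
  -- which is `1 - σ`.
  have hvalid : ∀ a ∈ arrange h c c (N - c) ++ finish h c,
      a.2 ≤ a.1 ∧ a.1 < n ∧ tail p (N - 1) ≤ tail p a.2 := by
    intro a ha
    rw [List.mem_append] at ha
    have : a.2 ≤ a.1 ∧ a.1 < N := by
      rcases ha with ha | ha
      · rcases mem_arrange ha with h1 | h1 <;> omega
      · have := mem_finish ha
        omega
    exact ⟨this.1, by omega, tail_anti hp (by omega)⟩
  obtain ⟨t, ht, hs⟩ := exists_minorization_of_leads hp hp1 hq ⟨_, hvalid⟩
    (z := sorted hmn) fun x => by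
      subst hN
      exact leads_sorted hmn hcN x
  refine ⟨t, ht.trans ?_, hs⟩
  simp only
  set l := arrange h c c (N - c) ++ finish h c with hl
  have hlen : l.length ≤ L := by
    have h1 := length_finish_le h hcN
    have h2 : h * c ≤ h * N := Nat.mul_le_mul_left h hcN
    have h3 : (N - c) * (h + h * c) ≤ N * (h + h * N) := Nat.mul_le_mul (by omega) (by omega)
    have h4 : c * (h * N) ≤ N * (h * N) := Nat.mul_le_mul_right _ hcN
    rw [hl, List.length_append, length_arrange]
    omega
  have hprod : κ ^ L * (1 / n) ^ (h * N) ≤ (l.map (odds p)).prod := by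
    have h1 := le_prod_odds_arrange (h := h) hκ0.le (by positivity : (0 : ℝ) ≤ 1 / n) hpop (N - c)
      hflat
    have h2 : κ ^ (finish h c).length ≤ ((finish h c).map (odds p)).prod := by
      refine pow_length_le_prod_map hκ0.le _ fun a ha => ?_
      obtain ⟨h1, h2⟩ := mem_finish ha
      have := hpop a.1 h2
      rwa [show a = (a.1, a.1) from Prod.ext rfl h1]
    rw [hl, List.map_append, List.prod_append]
    refine le_trans ?_ (mul_le_mul h1 h2 (by positivity) (le_trans (by positivity) h1))
    rw [mul_right_comm, ← pow_add, ← List.length_append]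
    have hn1 : 1 / (n : ℝ) ≤ 1 := by
      rw [div_le_one hn0]
      exact_mod_cast (by omega : 1 ≤ n)
    exact mul_le_mul (pow_le_pow_of_le_one hκ0.le hκ1 hlen)
      (pow_le_pow_of_le_one (by positivity) hn1 (Nat.mul_le_mul_left h (by omega)))
      (by positivity) (by positivity)
  calc 2 * ((l.length : ℝ) / (tail p (N - 1) * (l.map (odds p)).prod))
      ≤ 2 * ((L : ℝ) / (tail p (N - 1) * (κ ^ L * (1 / n) ^ (h * N)))) := by gcongr
    _ = _ := by
      rw [hκ]
      simp only [one_div, inv_pow]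
      field_simp

end Cost

/-! ### The bound -/

section Bound

variable {h n : ℕ} {m : Fin h → ℕ+} {p : Fin n → ℝ}

theorem prob_pos (hp : ∀ k, 0 < p k) {k : ℕ} (hk : 1 ≤ k ∧ k ≤ n) : 0 < prob p k := by
  rw [prob, dif_pos hk]
  exact hp _

theorem prob_anti (hanti : Antitone p) {j k : ℕ} (hj : 1 ≤ j) (hjk : j ≤ k) (hk : k ≤ n) :
    prob p k ≤ prob p j := by
  rw [prob, prob, dif_pos ⟨hj.trans hjk, hk⟩, dif_pos ⟨hj, hjk.trans hk⟩]
  exact hanti (Fin.le_def.2 (by simp only; omega))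

theorem sum_prob_Icc {r : ℕ} (hr : r ≤ n) :
    ∑ k ∈ Icc 1 r, prob p k = ∑ k ∈ popular n r, p k := by
  symm
  refine sum_nbij (fun k : Fin n => (k : ℕ) + 1) ?_ ?_ ?_ ?_
  · intro k hk
    rw [mem_popular] at hk
    exact mem_Icc.2 ⟨by omega, by omega⟩
  · intro j _ k _ hjk
    exact Fin.ext (by simpa using hjk)
  · intro k hk
    obtain ⟨h1, h2⟩ := mem_Icc.1 (mem_coe.1 hk)
    exact ⟨⟨k - 1, by omega⟩, mem_coe.2 (mem_popular.2 (by simp only; omega)),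
      by simp only; omega⟩
  · intro k _
    exact (prob_succ k).symm

/-- The `k`-th probability is the least of the first `k`, whose sum is at most one. -/
theorem mul_prob_le_one (hp : ∀ k, 0 < p k) (hp1 : ∑ k, p k = 1) (hanti : Antitone p) {k : ℕ}
    (hk : 1 ≤ k ∧ k ≤ n) : k * prob p k ≤ 1 := by
  have h1 : ∑ j ∈ Icc 1 k, prob p j ≤ 1 := by
    rw [sum_prob_Icc hk.2, ← hp1]
    exact sum_le_sum_of_subset_of_nonneg (subset_univ _) fun i _ _ => (hp i).le
  refine le_trans ?_ h1
  have h2 := card_nsmul_le_sum (Icc 1 k) (prob p) (prob p k) fun j hj =>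
    prob_anti hanti (mem_Icc.1 hj).1 (mem_Icc.1 hj).2 hk.2
  simpa using h2

theorem sum_filter_le_eq (f : Fin h → ℕ) (i : Fin h) :
    ∑ j ∈ univ.filter (· ≤ i), f j = ∑ j ∈ univ.filter (· < i), f j + f i := by
  have hi : i ∉ univ.filter (· < i) := by simp
  rw [add_comm, ← sum_insert hi]
  congr 1
  ext j
  simp [le_iff_lt_or_eq, or_comm]

theorem sum_filter_le_le (f : Fin h → ℕ) (i : Fin h) :
    ∑ j ∈ univ.filter (· ≤ i), f j ≤ ∑ j, f j := sum_le_sum_of_subset (subset_univ _)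

theorem sum_rev (m : Fin h → ℕ+) : ∑ j : Fin h, (m j.rev : ℕ) = totalSize m :=
  Fintype.sum_equiv Fin.revPerm _ _ fun _ => rfl

theorem card_Icc_block (f : Fin h → ℕ) (i : Fin h) :
    #(Icc (1 + ∑ j ∈ univ.filter (· < i), f j) (∑ j ∈ univ.filter (· ≤ i), f j)) = f i := by
  rw [sum_filter_le_eq, Nat.card_Icc]
  omega

theorem mem_Icc_block {f : Fin h → ℕ} {i : Fin h} {k : ℕ}
    (hk : k ∈ Icc (1 + ∑ j ∈ univ.filter (· < i), f j) (∑ j ∈ univ.filter (· ≤ i), f j)) :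
    1 ≤ k ∧ k ≤ ∑ j, f j := by
  have := sum_filter_le_le f i
  rw [mem_Icc] at hk
  omega

theorem bottomProd_pos (hmn : totalSize m < n) (hp : ∀ k, 0 < p k) : 0 < bottomProd m p := by
  refine prod_pos fun i _ => pow_pos (prod_pos fun k hk => ?_) _
  have : 1 ≤ k ∧ k ≤ totalSize m := mem_Icc_block hk
  exact prob_pos hp (by omega)

theorem bottomProd_le (hmn : totalSize m < n) (hp : ∀ k, 0 < p k) {u : ℝ}
    (hu : ∀ k, n - totalSize m < k → k ≤ n → prob p k ≤ u) :
    bottomProd m p ≤ u ^ weightedSize m := by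
  rw [bottomProd, weightedSize, ← prod_pow_eq_pow_sum]
  have hpos : ∀ (i : Fin h), ∀ k ∈ Icc (1 + ∑ j ∈ univ.filter (· < i), (m j : ℕ))
      (∑ j ∈ univ.filter (· ≤ i), (m j : ℕ)), 0 ≤ prob p (n + k - totalSize m) := by
    intro i k hk
    have : 1 ≤ k ∧ k ≤ totalSize m := mem_Icc_block hk
    exact (prob_pos hp (by omega)).le
  refine prod_le_prod (fun i _ => pow_nonneg (prod_nonneg (hpos i)) _) fun i _ => ?_
  rw [mul_comm, pow_mul]
  refine pow_le_pow_left₀ (prod_nonneg (hpos i)) ?_ _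
  rw [← card_Icc_block (fun j => (m j : ℕ)) i, ← prod_const]
  refine prod_le_prod (hpos i) fun k hk => ?_
  have : 1 ≤ k ∧ k ≤ totalSize m := mem_Icc_block hk
  exact hu _ (by omega) (by omega)

theorem weightedSize_eq_rev (m : Fin h → ℕ+) :
    weightedSize m = ∑ i : Fin h, (h - (i : ℕ)) * (m i.rev : ℕ) := by
  refine Fintype.sum_equiv Fin.revPerm _ _ fun i => ?_
  simp only [Fin.revPerm_apply, Fin.val_rev, Fin.rev_rev]
  congr 1
  omega

/-- The gain `v` comes from one factor, the most popular item. It lies in the block `i = 0`, whose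
exponent is `h ≥ 1`. -/
theorem le_topProd (hh : 1 ≤ h) {u v : ℝ} (hu0 : 0 ≤ u) (hv : 1 ≤ v)
    (hu : ∀ k, 1 ≤ k → k ≤ totalSize m → u ≤ prob p k) (huv : u * v ≤ prob p 1) :
    u ^ weightedSize m * v ≤ topProd m p := by
  have hv' : v = ∏ i : Fin h, if i = ⟨0, hh⟩ then v else 1 := by
    rw [prod_ite_eq' univ, if_pos (mem_univ _)]
  rw [topProd, weightedSize_eq_rev, ← prod_pow_eq_pow_sum, hv', ← prod_mul_distrib]
  refine prod_le_prod (fun i _ => by split_ifs <;> positivity) fun i _ => ?_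
  have hblock : ∀ k ∈ Icc (1 + ∑ j ∈ univ.filter (· < i), (m j.rev : ℕ))
      (∑ j ∈ univ.filter (· ≤ i), (m j.rev : ℕ)), u ≤ prob p k := by
    intro k hk
    have := mem_Icc_block (f := fun j => (m j.rev : ℕ)) hk
    rw [sum_rev] at this
    exact hu k this.1 this.2
  have hcard := card_Icc_block (fun j => (m j.rev : ℕ)) i
  set I := Icc (1 + ∑ j ∈ univ.filter (· < i), (m j.rev : ℕ))
      (∑ j ∈ univ.filter (· ≤ i), (m j.rev : ℕ)) with hI
  split_ifs with hi
  · have h1 : 1 ∈ I := by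
      have h0 : univ.filter (· < i) = ∅ := by
        rw [filter_eq_empty_iff]
        intro j _ hj
        rw [hi, Fin.lt_def] at hj
        exact Nat.not_lt_zero _ hj
      rw [hI, sum_filter_le_eq, h0, sum_empty, mem_Icc]
      have := (m i.rev).pos
      omega
    have hle : u ^ (m i.rev : ℕ) * v ≤ ∏ k ∈ I, prob p k := by
      rw [← hcard, ← mul_prod_erase I _ h1, ← card_erase_add_one h1, pow_succ]
      calc u ^ #(I.erase 1) * u * v = u * v * u ^ #(I.erase 1) := by ring
        _ ≤ _ := by
          refine mul_le_mul huv ?_ (by positivity) (le_trans (by positivity) huv)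
          rw [← prod_const]
          exact prod_le_prod (fun _ _ => hu0) fun k hk => hblock k (mem_of_mem_erase hk)
    have hexp : h - (i : ℕ) ≠ 0 := by have := i.isLt; omega
    calc u ^ ((h - (i : ℕ)) * (m i.rev : ℕ)) * v
        ≤ u ^ ((h - (i : ℕ)) * (m i.rev : ℕ)) * v ^ (h - (i : ℕ)) := by
          gcongr
          exact le_self_pow₀ hv hexp
      _ = (u ^ (m i.rev : ℕ) * v) ^ (h - (i : ℕ)) := by
          rw [mul_pow, ← pow_mul, mul_comm (h - (i : ℕ))]
      _ ≤ _ := pow_le_pow_left₀ (by positivity) hle _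
  · rw [mul_one, mul_comm, pow_mul]
    refine pow_le_pow_left₀ (by positivity) ?_ _
    rw [← hcard, ← prod_const]
    exact prod_le_prod (fun _ _ => hu0) hblock

theorem gapMass_eq (hmn : totalSize m < n) : 1 - gapMass m p = tail p (totalSize m - 1) := by
  rw [gapMass, tail, sum_prob_Icc (by omega)]

theorem le_totalSize (m : Fin h → ℕ+) : h ≤ totalSize m := by
  calc h = ∑ _i : Fin h, 1 := by simp
    _ ≤ totalSize m := sum_le_sum fun i _ => (m i).pos

theorem totalSize_le_weightedSize (m : Fin h → ℕ+) : totalSize m ≤ weightedSize m :=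
  sum_le_sum fun _ _ => Nat.le_mul_of_pos_left _ (Nat.succ_pos _)

theorem weightedSize_le (m : Fin h → ℕ+) : weightedSize m ≤ h * totalSize m := by
  rw [weightedSize, totalSize, mul_sum]
  exact sum_le_sum fun i _ => Nat.mul_le_mul_right _ i.isLt

/-- The powers of `n` to be compared in `le_mixingBound`. For `N ≥ 2` the product `(N - 1) * (M -
1)` absorbs both `h * N ≤ M * N` and the surplus in `M`; `N = 1` forces `h = M = 1`. -/
theorem exponent_le {h N M : ℕ} (h1 : 1 ≤ h) (h2 : h ≤ N) (h3 : N ≤ M) (h4 : M ≤ h * N) :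
    h * N + 4 * M ≤ 4 * N + 4 * (N - 1) * (M - 1) + (2 * M + 1) := by
  obtain ⟨a, rfl⟩ : ∃ a, N = a + 1 := ⟨N - 1, by omega⟩
  obtain ⟨b, rfl⟩ : ∃ b, M = b + 1 := ⟨M - 1, by omega⟩
  simp only [Nat.add_sub_cancel]
  have h5 : h * (a + 1) ≤ (b + 1) * (a + 1) := Nat.mul_le_mul_right _ (by omega)
  rcases Nat.eq_zero_or_pos a with rfl | ha
  · have : h = 1 := by omega
    subst this
    omega
  · have : b ≤ a * b := Nat.le_mul_of_pos_left b ha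
    nlinarith

/-- The bound of the theorem is at least of the order of `n ^ (h m) / (1 - σ)`. -/
theorem le_mixingBound (hh : 1 ≤ h) (hmn : totalSize m < n) (hp : ∀ k, 0 < p k)
    (hp1 : ∑ k, p k = 1) (hanti : Antitone p) :
    n ^ (h * totalSize m) / tail p (totalSize m - 1) ≤
      2 * (totalSize m : ℝ) ^ (2 * weightedSize m) * mixingBound m p := by
  have hN1 : 1 ≤ totalSize m := hh.trans (le_totalSize m)
  have hexp := exponent_le hh (le_totalSize m) (totalSize_le_weightedSize m) (weightedSize_le m)
  have hM1 : 1 ≤ weightedSize m := hN1.trans (totalSize_le_weightedSize m)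
  rw [mixingBound, gapMass_eq hmn]
  have hqpos : 0 < tail p (totalSize m - 1) := tail_pos hp hp1 (by omega)
  have hX1 : (1 : ℝ) ≤ n := by exact_mod_cast (by omega : 1 ≤ n)
  have hB0 := bottomProd_pos hmn hp
  have hprob0 : 0 < prob p n := prob_pos hp (by omega)
  have hprobq : prob p n ≤ tail p (totalSize m - 1) := by
    have h1 := le_tail hp hp1 (b := totalSize m - 1) ⟨n - 1, by omega⟩ (by simp only; omega)
    rwa [prob, dif_pos ⟨by omega, le_rfl⟩]
  have hprobn : n * prob p n ≤ 1 := mul_prob_le_one hp hp1 hanti (by omega)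
  have hq1 : tail p (totalSize m - 1) ≤ 1 := by
    have : 0 ≤ ∑ k ∈ popular n (totalSize m - 1), p k := sum_nonneg fun k _ => (hp k).le
    rw [tail]
    linarith
  have hNR : (1 : ℝ) ≤ totalSize m := by exact_mod_cast hN1
  -- For `k > n - N`, `p_k ≤ 1 / k ≤ N / n`, since `n ≤ N * (n - N + 1)`.
  have hBle : bottomProd m p ≤ ((totalSize m : ℝ) / n) ^ weightedSize m := by
    refine bottomProd_le hmn hp fun k hk hkn => ?_
    have h1 := mul_prob_le_one hp hp1 hanti (k := k) (by omega)
    have h2 : (n : ℝ) ≤ totalSize m * k := by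
      have : n ≤ totalSize m * k := by
        obtain ⟨d, hd⟩ : ∃ d, n = totalSize m + d := ⟨n - totalSize m, by omega⟩
        have h3 : totalSize m * (d + 1) ≤ totalSize m * k := Nat.mul_le_mul_left _ (by omega)
        have h4 : d ≤ totalSize m * d := Nat.le_mul_of_pos_left d hN1
        rw [mul_add] at h3
        omega
      exact_mod_cast this
    have h3 : 0 < prob p k := prob_pos hp (by omega)
    rw [le_div_iff₀ (by linarith)]
    nlinarith
  have hBhalf : bottomProd m p ≤ 1 / 2 := by
    have h1 : bottomProd m p ≤ (1 / 2) ^ weightedSize m := by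
      refine bottomProd_le hmn hp fun k hk hkn => ?_
      have h1 := mul_prob_le_one hp hp1 hanti (k := k) (by omega)
      have h2 : (2 : ℝ) ≤ k := by exact_mod_cast (by omega : 2 ≤ k)
      have h3 : 0 < prob p k := prob_pos hp (by omega)
      nlinarith
    exact h1.trans (pow_le_of_le_one (by norm_num) (by norm_num) (by omega))
  -- The logarithm is only needed to stay away from zero; `log 2 > 1 / 2` produces the factor 2 in
  -- the conclusion.
  have hlog : 1 / 2 ≤ Real.log (1 / bottomProd m p) := by
    have h1 : (2 : ℝ) ≤ 1 / bottomProd m p := by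
      rw [le_div_iff₀ hB0]
      linarith
    have := Real.log_le_log (by norm_num) h1
    linarith [Real.log_two_gt_d9]
  have hp_first : 1 ≤ n * prob p 1 := by
    have h1 := tail_le_mul hp1 (b := 0) (prob_pos hp (k := 1) (by omega)).le fun k _ => by
      rw [← prob_succ (p := p) k]
      exact prob_anti hanti le_rfl (by omega) (by omega)
    simpa [tail, popular] using h1
  -- With `q = tail p (N - 1)`, each of the `N` top probabilities is at least `q / n`, and the first
  -- is even at least `1 / n = (q / n) * (1 / q)`.
  have hT : (tail p (totalSize m - 1) / n) ^ weightedSize m * (1 / tail p (totalSize m - 1)) ≤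
      topProd m p := by
    refine le_topProd hh (by positivity) (by rwa [one_le_div hqpos]) (fun k hk hkN => ?_) ?_
    · rw [div_le_iff₀ (by linarith), mul_comm]
      refine tail_le_mul hp1 (prob_pos hp (by omega)).le fun j hj => ?_
      rw [← prob_succ (p := p) j]
      exact prob_anti hanti hk (by omega) (by omega)
    · rw [div_mul_div_comm, mul_one, div_le_iff₀ (by positivity)]
      nlinarith
  generalize tail p (totalSize m - 1) = q at *
  generalize topProd m p = T at *
  generalize Real.log (1 / bottomProd m p) = Λ at *
  generalize bottomProd m p = B at *
  generalize prob p n = r at *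
  generalize totalSize m = N at *
  generalize weightedSize m = M at *
  have hX0 : (0 : ℝ) < n := by linarith
  -- The extra `1 / q` just obtained completes `(1 / q) ^ (M - 1)` to the power `M`, so `q` cancels.
  have hTq : 1 / (n : ℝ) ^ M ≤ T * (1 / q) ^ (M - 1) := by
    calc 1 / (n : ℝ) ^ M = (q / n) ^ M * (1 / q) * (1 / q) ^ (M - 1) := by
          rw [mul_assoc, ← pow_succ', Nat.sub_add_cancel hM1, ← mul_pow, div_mul_div_comm, mul_one,
            mul_comm (n : ℝ), div_mul_cancel_left₀ hqpos.ne', inv_pow, one_div]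
      _ ≤ _ := by gcongr
  have hTq4 : 1 / (n : ℝ) ^ (4 * M) ≤ T ^ 4 * ((1 / q) ^ (M - 1)) ^ 4 := by
    rw [← mul_pow]
    calc 1 / (n : ℝ) ^ (4 * M) = (1 / (n : ℝ) ^ M) ^ 4 := by
          rw [one_div_pow, ← pow_mul, mul_comm]
      _ ≤ _ := by gcongr
  -- From `r ≤ q` and `n * r ≤ 1`, `r ^ 2 ≤ q / n`; this supplies the factor `1 / q` of the target.
  have hBr : B ^ 2 * r ^ 2 ≤ (N : ℝ) ^ (2 * M) / (n : ℝ) ^ (2 * M + 1) * q := by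
    have h1 : r ^ 2 ≤ q / n := by
      rw [le_div_iff₀ hX0]
      nlinarith
    calc B ^ 2 * r ^ 2 ≤ (((N : ℝ) / n) ^ M) ^ 2 * (q / n) := by gcongr
      _ = _ := by
        rw [← pow_mul, mul_comm M 2, div_pow, pow_succ]
        field_simp
  have hN0 : (0 : ℝ) < N := by linarith
  have hpow : (n : ℝ) ^ (h * N + 4 * M) ≤
      (n : ℝ) ^ (4 * N + 4 * (N - 1) * (M - 1)) * (n : ℝ) ^ (2 * M + 1) := by
    rw [← pow_add]
    exact pow_le_pow_right₀ hX1 hexp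
  have hmain : (n : ℝ) ^ (h * N) / q ≤ (N : ℝ) ^ (2 * M) *
      ((n : ℝ) ^ (4 * N + 4 * (N - 1) * (M - 1)) / (B ^ 2 * r ^ 2) * (1 / (n : ℝ) ^ (4 * M))) := by
    calc (n : ℝ) ^ (h * N) / q
        = (n : ℝ) ^ (h * N + 4 * M) / (q * (n : ℝ) ^ (4 * M)) := by
          rw [pow_add]
          field_simp
      _ ≤ (n : ℝ) ^ (4 * N + 4 * (N - 1) * (M - 1)) * (n : ℝ) ^ (2 * M + 1) /
            (q * (n : ℝ) ^ (4 * M)) := by gcongr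
      _ = (N : ℝ) ^ (2 * M) * ((n : ℝ) ^ (4 * N + 4 * (N - 1) * (M - 1)) /
            ((N : ℝ) ^ (2 * M) / (n : ℝ) ^ (2 * M + 1) * q) * (1 / (n : ℝ) ^ (4 * M))) := by
          field_simp
      _ ≤ _ := by gcongr
  calc (n : ℝ) ^ (h * N) / q ≤ _ := hmain
    _ ≤ (N : ℝ) ^ (2 * M) * ((n : ℝ) ^ (4 * N + 4 * (N - 1) * (M - 1)) / (B ^ 2 * r ^ 2) *
          (T ^ 4 * ((1 / q) ^ (M - 1)) ^ 4)) * (2 * Λ) := by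
        refine le_trans ?_ (le_mul_of_one_le_right (by positivity) (by linarith))
        gcongr
    _ = _ := by ring

end Bound

end LRUm

/-! ### The mixing time bound -/

theorem mainTheorem4 (h : ℕ) (hh : 1 ≤ h) (m : Fin h → ℕ+) :
    ∃ C : ℝ, 0 < C ∧ ∀ (n : ℕ), LRUm.totalSize m < n →
      ∀ p : Fin n → ℝ, (∀ k, 0 < p k) → ∑ k, p k = 1 → Antitone p →
        ∃ π : LRUm.State m n → ℝ,
          LRUm.IsStationary (LRUm.transition m p) π ∧
          (∀ π', LRUm.IsStationary (LRUm.transition m p) π' → π' = π) ∧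
          ∃ t : ℕ, LRUm.IsMixingTime (LRUm.transition m p) π (1 / 2) t ∧
            (t : ℝ) ≤ C * LRUm.mixingBound m p := by
  classical
  obtain ⟨N, hN⟩ : ∃ N, N = LRUm.totalSize m := ⟨_, rfl⟩
  have hN1 : 1 ≤ N := hN ▸ hh.trans (LRUm.le_totalSize m)
  obtain ⟨L, hL⟩ : ∃ L, L = h * N + N * (h + h * N) + N * (h * N) := ⟨_, rfl⟩
  have hL1 : 1 ≤ L := by
    have : 1 ≤ h * N := Nat.mul_pos hh hN1
    omega
  -- The product of the constants of `exists_minorization_time` and `le_mixingBound`, both functions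
  -- of `m` alone.
  refine ⟨2 * (L * (N + 1) ^ L) * (2 * (N : ℝ) ^ (2 * LRUm.weightedSize m)), by positivity,
    fun n hmn p hp hp1 hanti => ?_⟩
  have h1 := LRUm.transition_row_sum (m := m) hp1
  have : Nonempty (LRUm.State m n) := ⟨LRUm.sorted hmn⟩
  obtain ⟨π, hπ⟩ := LRUm.exists_isStationary (LRUm.transition_nonneg (m := m) hp) h1
  obtain ⟨t, ht, s, hs, hsP⟩ :=
    LRUm.exists_minorization_time hh hmn hp hp1 hanti hN hN1 hL
  have hmix : ∀ x, LRUm.tvDist (fun y => (LRUm.transition m p ^ t) x y) π ≤ 1 / 2 := fun x =>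
    (LRUm.tvDist_le_of_minorization h1 hπ hsP x).trans (by linarith)
  have hex : ∃ t, ∀ x, LRUm.tvDist (fun y => (LRUm.transition m p ^ t) x y) π ≤ 1 / 2 := ⟨t, hmix⟩
  refine ⟨π, hπ, fun π' hπ' => hπ.eq_of_minorization h1 hπ' hsP (by linarith), Nat.find hex,
    ⟨?_, fun t' ht' => Nat.find_min' hex ?_⟩, ?_⟩
  · exact Nat.find_spec hex
  · exact ht'
  · have hle : (Nat.find hex : ℝ) ≤ t := by exact_mod_cast Nat.find_min' hex hmix
    have hb := LRUm.le_mixingBound hh hmn hp hp1 hanti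
    rw [← hN] at hb
    calc (Nat.find hex : ℝ) ≤ t := hle
      _ ≤ _ := ht
      _ ≤ 2 * (L * (N + 1) ^ L) * (2 * (N : ℝ) ^ (2 * LRUm.weightedSize m) *
            LRUm.mixingBound m p) := by gcongr
      _ = _ := by ring
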